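/- Let $G$ be a plane triangulation, i.e. a finite connected simple graph with at least three vertices embedded in the plane so that every face (the outer face included) is bounded by a triangle; the embedding is taken combinatorially, as a rotation system (a cyclic order of the edges around each vertex) whose faces, obtained by face tracing, satisfy Euler's formula $|V|-|E|+|F|=2$. Let the vertices $x_1,\dots,x_n$ of $G$ be linearly ordered by their indices, and let $T$ be any triangle in $G$, i.e. any three pairwise adjacent vertices (not necessarily bounding a face), with edge set $E(T)$. Let $\mathbb F$ be an arbitrary field, and let every edge $e=x_ix_j$ $(i<j)$ of $G-E(T)$ be assigned an arbitrary pair $(a_e,b_e)$ of non-zero elements of $\mathbb F$. Then the decorated graph polynomial $$D_{G-E(T)}(x_1,\dots,x_n)=\prod_{e=x_ix_j\in E(G)\setminus E(T),\ i<j}(a_ex_i+b_ex_j)\in\mathbb F[x_1,\dots,x_n]$$ has a monomial $N$ with non-zero coefficient such that $\deg_u(N)=0$ for every vertex $u$ of $T$ and $\deg_w(N)\le 4$ for every other vertex $w$. -/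

import Mathlib

/-- A rotation system on a simple graph `G`, i.e. a combinatorial embedding of `G` in an oriented
surface: at every vertex `v` the darts (oriented edges) leaving `v` are put into one cyclic order.
`next d` is the dart that follows `d` in the rotation around its tail `d.fst`. -/
structure RotationSystem {V : Type*} (G : SimpleGraph V) where
  next : Equiv.Perm G.Dart
  fst_next : ∀ d : G.Dart, (next d).fst = d.fst
  sameCycle_of_fst_eq : ∀ d d' : G.Dart, d.fst = d'.fst → next.SameCycle d d'

namespace RotationSystem

variable {V : Type*} {G : SimpleGraph V}

/-- The face-tracing permutation: walk along the dart `d = (u, v)` and continue with the dart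
that follows the reversed dart `(v, u)` in the rotation around `v`. -/
def facePerm (R : RotationSystem G) : Equiv.Perm G.Dart :=
  (Function.Involutive.toPerm SimpleGraph.Dart.symm SimpleGraph.Dart.symm_involutive).trans R.next

/-- The faces of the embedding are the orbits of the face-tracing permutation. -/
def Face (R : RotationSystem G) : Type _ :=
  Quotient (Equiv.Perm.SameCycle.setoid R.facePerm)

/-- The embedding is plane (the surface is the sphere, i.e. the compactified plane): the graph is
connected and the Euler characteristic satisfies `|V| - |E| + |F| = 2`. -/
def IsPlane [Fintype V] (R : RotationSystem G) : Prop :=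
  G.Connected ∧ (Nat.card V : ℤ) - (Nat.card G.edgeSet : ℤ) + (Nat.card R.Face : ℤ) = 2

/-- A plane triangulation: a plane embedding all of whose faces (the outer one included) are
bounded by triangles, i.e. every face-tracing walk closes up after exactly three steps (it cannot
close up after one step because `G` has no loops). -/
def IsPlaneTriangulation [Fintype V] (R : RotationSystem G) : Prop :=
  R.IsPlane ∧ ∀ d : G.Dart, R.facePerm (R.facePerm (R.facePerm d)) = d

end RotationSystem

/-- A decoration of the edges of `H` over the field `F`: every edge `e` gets a pair
`(a e, b e)` of non-zero field elements (values outside the edge set are irrelevant). -/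
structure EdgeDecoration {V : Type*} (H : SimpleGraph V) (F : Type*) [Field F] where
  a : Sym2 V → F
  b : Sym2 V → F
  a_ne_zero : ∀ e ∈ H.edgeSet, a e ≠ 0
  b_ne_zero : ∀ e ∈ H.edgeSet, b e ≠ 0

open Classical in
/-- The decorated graph polynomial `∏ (a_e x_i + b_e x_j)` over the edges `e = x_i x_j`, `i < j`,
of `H`. The two endpoints of `e` are `e.inf < e.sup`. -/
noncomputable def decoratedPolynomial {V : Type*} [Fintype V] [LinearOrder V]
    (H : SimpleGraph V) {F : Type*} [Field F] (δ : EdgeDecoration H F) : MvPolynomial V F :=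
  ∏ e ∈ H.edgeFinset,
    (MvPolynomial.C (δ.a e) * MvPolynomial.X e.inf + MvPolynomial.C (δ.b e) * MvPolynomial.X e.sup)

/-! The triangle `T` is a closed curve that cuts the sphere into two disks, and each disk is treated
by an induction in the style of Thomassen's proof that planar graphs are 5-choosable, with monomials
in place of list colourings.

The induction claim is `IsDisk.exists_monomial`: for a triangulated disk with a boundary edge `xy`,
the product over all edges except `xy` has a monomial of degree 0 at `x` and `y`, at most 2 on the
boundary and at most 4 elsewhere. Let `v` be the boundary neighbour of `x` other than `y`. If there
is a chord `vc`, it splits the disk; in the part away from `xy` the chord takes the role of `xy`, so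
the monomial of that part avoids `v` and `c`, and the two monomials multiply without cancellation
(`coeff_add_mul_of_disjoint`). If there is no chord, delete `v`. Its inner neighbours become
boundary vertices, so they have degree at most 2 and room for one edge to `v` each. The edge `vx`
must contribute `v`, and so may the edge `vw` to the next boundary vertex. Should this coefficient
cancel, the cancelling term reveals another monomial, of smaller degree in `w`, and then `w` can
take the edge `vw` (`exists_monomial_restore_vertex`).

When the boundary is a triangle `abc` and `ab` is the special edge, both other sides must contribute
`c`; dividing by `c²` leaves a monomial free of `a`, `b`, `c`. The product of those from the two
sides of `T` is the required one.

The Jordan curve theorem enters in a mod 2 form: Euler's formula makes the first homology vanish, so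
every cycle bounds a set of faces (`range_faceBoundary`). Sets of triangles are recorded by their
darts. -/

open MvPolynomial

/-! ### Coefficients of products of linear forms. -/

section PolynomialLemmas

variable {V F : Type*} [Field F]

/-- `lin` attaches to every edge `ij` of `G` a linear form `a x_i + b x_j` with `a, b ≠ 0`. -/
def IsEdgeForm (G : SimpleGraph V) (lin : Sym2 V → MvPolynomial V F) : Prop :=
  ∀ i j, G.Adj i j → ∃ a b : F, a ≠ 0 ∧ b ≠ 0 ∧ lin s(i, j) = C a * X i + C b * X j

theorem coeff_add_single_linear_mul {v z : V} (hvz : v ≠ z) (a b : F) (M : V →₀ ℕ)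
    (hM : M z = 0) (P : MvPolynomial V F) :
    coeff (M + Finsupp.single v 1) ((C a * X v + C b * X z) * P) = a * coeff M P := by
  classical
  rw [add_mul, coeff_add, mul_assoc, coeff_C_mul, mul_assoc, coeff_C_mul, coeff_X_mul',
    coeff_X_mul', if_pos, if_neg]
  · simp
  · simp [hM, hvz]
  · simp

theorem coeff_linear_mul_ne_zero {i j : V} {a b : F} {N : V →₀ ℕ} {P : MvPolynomial V F}
    (hj : N j = 0) (h : coeff N ((C a * X i + C b * X j) * P) ≠ 0) :
    ∃ M, N = M + Finsupp.single i 1 ∧ coeff M P ≠ 0 := by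
  classical
  rw [add_mul, coeff_add, mul_assoc, coeff_C_mul, mul_assoc, coeff_C_mul, coeff_X_mul',
    coeff_X_mul', if_neg (c := j ∈ N.support) (by simp [hj])] at h
  by_cases hi : i ∈ N.support
  · rw [if_pos hi] at h
    refine ⟨N - Finsupp.single i 1, ?_, fun h0 => h (by simp [h0])⟩
    rw [tsub_add_cancel_of_le]
    simpa [Nat.one_le_iff_ne_zero] using hi
  · simp [hi] at h

/-- Coefficients of a product of polynomials that share only variables which do not occur in the
monomial taken from the second, homogeneous, factor. -/
theorem coeff_add_mul_of_disjoint {P Q : MvPolynomial V F} {n : ℕ} (hQ : Q.IsHomogeneous n)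
    {A B : Set V} (hPA : ∀ M, coeff M P ≠ 0 → ∀ z ∉ A, M z = 0)
    (hQB : ∀ M, coeff M Q ≠ 0 → ∀ z ∉ B, M z = 0) {N₁ N₂ : V →₀ ℕ} (h₁ : coeff N₁ P ≠ 0)
    (h₂ : coeff N₂ Q ≠ 0) (h : ∀ z ∈ A, z ∈ B → N₂ z = 0) :
    coeff (N₁ + N₂) (P * Q) = coeff N₁ P * coeff N₂ Q := by
  classical
  rw [coeff_mul]
  refine Finset.sum_eq_single (N₁, N₂) ?_ (by simp)
  rintro ⟨M₁, M₂⟩ hM hne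
  rw [Finset.HasAntidiagonal.mem_antidiagonal] at hM
  by_contra h0
  have hM₁ : coeff M₁ P ≠ 0 := left_ne_zero_of_mul h0
  have hM₂ : coeff M₂ Q ≠ 0 := right_ne_zero_of_mul h0
  -- Outside `A` the first factor contributes nothing, so `M₂` and `N₂` agree there; on `A` the
  -- monomial `N₂` vanishes. Homogeneity then upgrades `N₂ ≤ M₂` to equality.
  have hle : N₂ ≤ M₂ := by
    intro z
    have hz : M₁ z + M₂ z = N₁ z + N₂ z := by simpa using DFunLike.congr_fun hM z
    by_cases hA : z ∈ A
    · by_cases hB : z ∈ B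
      · simp [h z hA hB]
      · simp [hQB _ h₂ z hB]
    · have := hPA _ hM₁ z hA
      have := hPA _ h₁ z hA
      omega
  obtain ⟨K, rfl⟩ := exists_add_of_le hle
  have hdeg : Finsupp.degree (N₂ + K) = Finsupp.degree N₂ := by
    rw [Finsupp.degree_eq_weight_one]
    exact (hQ hM₂).trans (hQ h₂).symm
  have hK : K = 0 := by
    rw [map_add] at hdeg
    exact (Finsupp.degree_eq_zero_iff K).1 (by omega)
  subst hK
  rw [add_zero] at hM hne
  exact hne (Prod.ext (add_right_cancel hM) rfl)

/-- The target monomial does not contain `v`, so every factor is forced to contribute its `u`. -/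
theorem coeff_prod_linear_mul {v : V} (a b : V → F) (P : MvPolynomial V F) (U : Finset V)
    (hvU : v ∉ U) (M : V →₀ ℕ) (hM : M v = 0) :
    coeff (M + ∑ u ∈ U, Finsupp.single u 1) ((∏ u ∈ U, (C (a u) * X v + C (b u) * X u)) * P)
      = (∏ u ∈ U, b u) * coeff M P := by
  classical
  induction U using Finset.induction_on with
  | empty => simp
  | insert u U hu ih =>
    simp only [Finset.mem_insert, not_or] at hvU
    rw [Finset.sum_insert hu, Finset.prod_insert hu, Finset.prod_insert hu,
      add_comm (Finsupp.single u 1), ← add_assoc, add_comm (C (a u) * X v), mul_assoc,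
      coeff_add_single_linear_mul (Ne.symm hvU.1), ih hvU.2, mul_assoc]
    simp only [Finsupp.add_apply, hM, zero_add, Finsupp.finsetSum_apply]
    exact Finset.sum_eq_zero fun z hz => Finsupp.single_eq_of_ne fun h => hvU.2 (h ▸ hz)

/-- The target has degree one in `v` and `P` is free of `v`, so exactly one factor contributes `v`;
the variable `u` which that factor fails to supply must come from `P`. -/
theorem exists_coeff_ne_zero_of_prod_linear_mul {v : V} {a b : V → F} {P : MvPolynomial V F}
    (hP : ∀ M, coeff M P ≠ 0 → M v = 0) {U : Finset V} (hvU : v ∉ U) {M : V →₀ ℕ}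
    (hM : M v = 0)
    (h : coeff (M + Finsupp.single v 1 + ∑ u ∈ U, Finsupp.single u 1)
      ((∏ u ∈ U, (C (a u) * X v + C (b u) * X u)) * P) ≠ 0) :
    ∃ u ∈ U, coeff (M + Finsupp.single u 1) P ≠ 0 := by
  classical
  induction U using Finset.induction_on with
  | empty =>
    have := hP (M + Finsupp.single v 1) (by simpa using h)
    simp at this
  | insert u U hu ih =>
    simp only [Finset.mem_insert, not_or] at hvU
    rw [Finset.sum_insert hu, Finset.prod_insert hu, mul_assoc, add_mul, coeff_add, mul_assoc,
      coeff_C_mul, mul_assoc, coeff_C_mul] at h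
    by_cases h' : coeff (M + Finsupp.single v 1 + ∑ u ∈ U, Finsupp.single u 1)
      ((∏ u ∈ U, (C (a u) * X v + C (b u) * X u)) * P) = 0
    · rw [show M + Finsupp.single v 1 + (Finsupp.single u 1 + ∑ u ∈ U, Finsupp.single u 1) =
        Finsupp.single u 1 + (M + Finsupp.single v 1 + ∑ u ∈ U, Finsupp.single u 1) by abel,
        coeff_X_mul, h', mul_zero, add_zero,
        show Finsupp.single u 1 + (M + Finsupp.single v 1 + ∑ u ∈ U, Finsupp.single u 1) =
        Finsupp.single v 1 + (M + Finsupp.single u 1 + ∑ u ∈ U, Finsupp.single u 1) by abel,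
        coeff_X_mul, coeff_prod_linear_mul a b P U hvU.2 _
          (by simp [hM, Finsupp.single_eq_of_ne hvU.1])] at h
      exact ⟨u, by simp, right_ne_zero_of_mul (right_ne_zero_of_mul h)⟩
    · obtain ⟨z, hz, h⟩ := ih hvU.2 h'
      exact ⟨z, Finset.mem_insert_of_mem hz, h⟩

/-- Restoring a vertex `v` whose neighbours are `x`, `w` and the vertices of `U`. -/
theorem exists_monomial_restore_vertex {v x w y : V} {U : Finset V} {B : Set V} {a b : V → F}
    (ha : ∀ z, z = x ∨ z = w → a z ≠ 0) (hb : ∀ z, z = w ∨ z ∈ U → b z ≠ 0)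
    {P : MvPolynomial V F} (hP : ∀ M, coeff M P ≠ 0 → M v = 0)
    (hvU : v ∉ U) (hvx : v ≠ x) (hvw : v ≠ w) (hvy : v ≠ y) (hxw : x ≠ w)
    (hUB : ∀ u ∈ U, u ∉ B) (hx : x ∈ B) (hw : w ∈ B) (hy : y ∈ B) {N : V →₀ ℕ}
    (hN : coeff N P ≠ 0) (hNx : N x = 0) (hNy : N y = 0)
    (hN2 : ∀ z, z ∈ B ∨ z ∈ U → N z ≤ 2) (hN4 : ∀ z, N z ≤ 4) :
    ∃ N : V →₀ ℕ, coeff N ((C (a x) * X v + C (b x) * X x) * ((C (a w) * X v + C (b w) * X w) *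
        ((∏ u ∈ U, (C (a u) * X v + C (b u) * X u)) * P))) ≠ 0 ∧
      N x = 0 ∧ N y = 0 ∧ N v ≤ 2 ∧ (∀ z ∈ B, z ≠ v → N z ≤ 2) ∧ ∀ z, N z ≤ 4 := by
  classical
  set W : V →₀ ℕ := ∑ u ∈ U, Finsupp.single u 1 with hW
  have hWB : ∀ z, W z = if z ∈ U then 1 else 0 := by
    intro z
    simp [hW, Finsupp.finsetSum_apply, Finsupp.single_apply]
  have hWB' : ∀ z ∈ B, W z = 0 := fun z hz => by
    rw [hWB, if_neg fun h => hUB z h hz]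
  have hWv : W v = 0 := by rw [hWB, if_neg hvU]
  have hWle : ∀ z, W z ≤ 1 := fun z => by rw [hWB]; split_ifs <;> simp
  have hNv := hP N hN
  have hbU : ∏ u ∈ U, b u ≠ 0 := Finset.prod_ne_zero_iff.2 fun u hu => hb u (.inr hu)
  have hsx : Finsupp.single w 1 x = 0 := Finsupp.single_eq_of_ne hxw
  have hsvx : Finsupp.single v 1 x = 0 := Finsupp.single_eq_of_ne hvx.symm
  have hsvy : Finsupp.single v 1 y = 0 := Finsupp.single_eq_of_ne hvy.symm
  have hsvw : Finsupp.single v 1 w = 0 := Finsupp.single_eq_of_ne hvw.symm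
  have hswv : Finsupp.single w 1 v = 0 := Finsupp.single_eq_of_ne hvw
  -- the monomial with `v`-degree two, if it does not cancel
  have two : coeff (N + W + Finsupp.single v 1) ((C (a w) * X v + C (b w) * X w) *
        ((∏ u ∈ U, (C (a u) * X v + C (b u) * X u)) * P)) ≠ 0 →
      ∃ N : V →₀ ℕ, coeff N ((C (a x) * X v + C (b x) * X x) *
        ((C (a w) * X v + C (b w) * X w) *
          ((∏ u ∈ U, (C (a u) * X v + C (b u) * X u)) * P))) ≠ 0 ∧
      N x = 0 ∧ N y = 0 ∧ N v ≤ 2 ∧ (∀ z ∈ B, z ≠ v → N z ≤ 2) ∧ ∀ z, N z ≤ 4 := by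
    intro h
    refine ⟨N + W + Finsupp.single v 1 + Finsupp.single v 1, ?_, ?_, ?_, ?_, ?_, ?_⟩
    · rw [coeff_add_single_linear_mul hvx]
      · exact mul_ne_zero (ha x (.inl rfl)) h
      · simp [hNx, hWB' x hx, hsvx]
    · simp [hNx, hWB' x hx, hsvx]
    · simp [hNy, hWB' y hy, hsvy]
    · simp [hNv, hWv]
    · intro z hz hzv
      simpa [hWB' z hz, Finsupp.single_eq_of_ne hzv] using hN2 z (.inl hz)
    · intro z
      by_cases hzv : z = v
      · subst hzv; simp [hNv, hWv]
      · have h4 := hN4 z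
        have h2 := hN2 z
        have := hWB z
        simp only [Finsupp.add_apply, Finsupp.single_eq_of_ne hzv]
        split_ifs at this with hzU
        · have := h2 (.inr hzU); omega
        · omega
  by_cases hNw : N w = 0
  · apply two
    rw [coeff_add_single_linear_mul hvw _ _ _ (by simp [hNw, hWB' w hw]),
      coeff_prod_linear_mul a b P U hvU N hNv]
    exact mul_ne_zero (ha w (.inr rfl)) (mul_ne_zero hbU hN)
  have hwy : y ≠ w := fun h => hNw (h ▸ hNy)
  -- Such an `M` has one degree to spare at `w` and on `U`, so `w` and all of `U` can take their
  -- edges to `v`, leaving `v` with degree one, from the edge `vx`.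
  by_cases hex : ∃ M, coeff M P ≠ 0 ∧ M x = 0 ∧ M y = 0 ∧ M w ≤ 1 ∧ (∀ z ∈ B, M z ≤ 2) ∧
      (∀ z ∈ U, M z ≤ 3) ∧ ∀ z, M z ≤ 4
  · obtain ⟨M, hM, hMx, hMy, hMw, hMB, hMU, hM4⟩ := hex
    have hMv := hP M hM
    refine ⟨M + W + Finsupp.single w 1 + Finsupp.single v 1, ?_, ?_, ?_, ?_, ?_, ?_⟩
    · rw [coeff_add_single_linear_mul hvx _ _ _ (by simp [hMx, hWB' x hx, hsx]),
        add_comm (C (a w) * X v),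
        coeff_add_single_linear_mul hvw.symm _ _ _ (by simp [hMv, hWv]),
        coeff_prod_linear_mul a b P U hvU M hMv]
      exact mul_ne_zero (ha x (.inl rfl)) (mul_ne_zero (hb w (.inl rfl)) (mul_ne_zero hbU hM))
    · simp [hMx, hWB' x hx, hsvx, hsx]
    · simp [hMy, hWB' y hy, hsvy, Finsupp.single_eq_of_ne hwy]
    · simp [hMv, hWv, hswv]
    · intro z hz hzv
      by_cases hzw : z = w
      · subst hzw
        simpa [hWB' z hz, hsvw] using hMw
      · simpa [hWB' z hz, Finsupp.single_eq_of_ne hzv, Finsupp.single_eq_of_ne hzw] using hMB z hz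
    · intro z
      by_cases hzv : z = v
      · subst hzv; simp [hMv, hWv, hswv]
      by_cases hzw : z = w
      · subst hzw
        simp [hWB' z hw, hsvw]; omega
      have h4 := hM4 z
      have h2 := hMU z
      have := hWB z
      simp only [Finsupp.add_apply, Finsupp.single_eq_of_ne hzv, Finsupp.single_eq_of_ne hzw]
      split_ifs at this with hzU
      · have := h2 hzU; omega
      · omega
  · apply two
    obtain ⟨K, rfl⟩ : ∃ K, N = K + Finsupp.single w 1 :=
      ⟨N - Finsupp.single w 1, by
        rw [tsub_add_cancel_of_le]; simpa [Nat.one_le_iff_ne_zero] using hNw⟩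
    have hKv : K v = 0 := by simpa [hswv] using hNv
    -- This is the only term that could cancel the leading one, the term where `vw` contributes `w`.
    -- If it were non-zero, some `K + single u 1` would occur in `P`: one less than `N` at `w` and
    -- one more at a single `u ∈ U`, exactly what was just excluded.
    have hK : coeff (K + Finsupp.single v 1 + W)
        ((∏ u ∈ U, (C (a u) * X v + C (b u) * X u)) * P) = 0 := by
      by_contra h
      obtain ⟨u, hu, hcu⟩ := exists_coeff_ne_zero_of_prod_linear_mul hP hvU hKv h
      have huB := hUB u hu
      have hzu : ∀ z ∈ B, Finsupp.single u 1 z = 0 := fun z hz =>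
        Finsupp.single_eq_of_ne fun h => huB (h ▸ hz)
      simp only [Finsupp.add_apply] at hNx hNy hN2 hN4
      have hle : ∀ z, Finsupp.single u 1 z ≤ 1 := fun z => by
        rw [Finsupp.single_apply]; split_ifs <;> simp
      refine hex ⟨_, hcu, ?_, ?_, ?_, ?_, ?_, ?_⟩
      · simp only [Finsupp.add_apply, hzu x hx]; omega
      · simp only [Finsupp.add_apply, hzu y hy]; omega
      · have := hN2 w (.inl hw)
        simp only [Finsupp.single_eq_same] at this
        simp only [Finsupp.add_apply, hzu w hw]; omega
      · intro z hz
        have := hN2 z (.inl hz)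
        simp only [Finsupp.add_apply, hzu z hz]; omega
      · intro z hz
        have := hN2 z (.inr hz)
        have := hle z
        simp only [Finsupp.add_apply]; omega
      · intro z
        have := hN4 z
        simp only [Finsupp.add_apply]
        by_cases hz : z = u
        · subst hz
          have := hN2 z (.inr hu)
          have := hle z
          omega
        · rw [Finsupp.single_eq_of_ne hz]; omega
    rw [add_mul, coeff_add, mul_assoc, coeff_C_mul, mul_assoc, coeff_C_mul,
      show K + Finsupp.single w 1 + W + Finsupp.single v 1 =
        Finsupp.single w 1 + (K + Finsupp.single v 1 + W) by abel, coeff_X_mul, hK, mul_zero,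
      add_zero, show Finsupp.single w 1 + (K + Finsupp.single v 1 + W) =
        Finsupp.single v 1 + (K + Finsupp.single w 1 + W) by abel, coeff_X_mul,
      coeff_prod_linear_mul a b P U hvU _ hNv]
    exact mul_ne_zero (ha w (.inr rfl)) (mul_ne_zero hbU hN)

section EdgeProducts

variable {G : SimpleGraph V} {lin : Sym2 V → MvPolynomial V F}

theorem isHomogeneous_prod_edgeForm (hlin : IsEdgeForm G lin) {E : Finset (Sym2 V)}
    (hE : ∀ e ∈ E, e ∈ G.edgeSet) : (∏ e ∈ E, lin e).IsHomogeneous (∑ _e ∈ E, 1) := by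
  refine IsHomogeneous.prod _ _ _ fun e he => ?_
  induction e with | _ i j
  obtain ⟨a, b, -, -, h⟩ := hlin i j (hE _ he)
  rw [h]
  refine IsHomogeneous.add ?_ ?_
  · simpa using (isHomogeneous_C V a).mul (isHomogeneous_X F i)
  · simpa using (isHomogeneous_C V b).mul (isHomogeneous_X F j)

theorem eq_zero_of_coeff_prod_edgeForm_ne_zero (hlin : IsEdgeForm G lin) {E : Finset (Sym2 V)}
    (hE : ∀ e ∈ E, e ∈ G.edgeSet) {z : V} (hz : ∀ e ∈ E, z ∉ e) {M : V →₀ ℕ}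
    (hM : coeff M (∏ e ∈ E, lin e) ≠ 0) : M z = 0 := by
  classical
  induction E using Finset.induction_on generalizing M with
  | empty =>
    rw [Finset.prod_empty, coeff_one] at hM
    have : 0 = M := by by_contra h; simp [h] at hM
    simp [← this]
  | insert e E he ih =>
    rw [Finset.prod_insert he] at hM
    have ih' := fun M => @ih (fun e h => hE e (Finset.mem_insert_of_mem h))
      (fun e h => hz e (Finset.mem_insert_of_mem h)) M
    have hze := hz e (Finset.mem_insert_self _ _)
    have hEe := hE e (Finset.mem_insert_self _ _)
    induction e with | _ i j
    obtain ⟨a, b, -, -, h⟩ := hlin i j hEe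
    simp only [Sym2.mem_iff, not_or] at hze
    rw [h, add_mul, coeff_add, mul_assoc, coeff_C_mul, mul_assoc, coeff_C_mul, coeff_X_mul',
      coeff_X_mul'] at hM
    by_contra hMz
    have key : ∀ k, z ≠ k → coeff (M - Finsupp.single k 1) (∏ e ∈ E, lin e) = 0 := by
      intro k hk
      by_contra hne
      have := ih' _ hne
      simp [Finsupp.single_eq_of_ne hk] at this
      exact hMz this
    simp [key i hze.1, key j hze.2] at hM

end EdgeProducts

end PolynomialLemmas

/-! ### Consecutive pairs in a list, used to describe boundary curves. -/

section Consecutive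

variable {V : Type*}

/-- `b` follows immediately after `a` in the list. -/
def Consec : List V → V → V → Prop
  | a :: b :: l, i, j => (i = a ∧ j = b) ∨ Consec (b :: l) i j
  | _, _, _ => False

@[simp] theorem consec_nil (i j : V) : Consec [] i j ↔ False := Iff.rfl

@[simp] theorem consec_singleton (a i j : V) : Consec [a] i j ↔ False := Iff.rfl

@[simp] theorem consec_cons_cons (a b : V) (l : List V) (i j : V) :
    Consec (a :: b :: l) i j ↔ (i = a ∧ j = b) ∨ Consec (b :: l) i j := Iff.rfl

theorem consec_append_cons (l : List V) (a : V) (m : List V) (i j : V) :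
    Consec (l ++ a :: m) i j ↔ Consec (l ++ [a]) i j ∨ Consec (a :: m) i j := by
  induction l with
  | nil => simp
  | cons b l ih =>
    cases l with
    | nil => simp
    | cons c l => simpa [or_assoc] using or_congr_right ih

theorem Consec.mem_tail {l : List V} {i j : V} (h : Consec l i j) : j ∈ l.tail := by
  induction l with
  | nil => exact h.elim
  | cons a l ih =>
    cases l with
    | nil => exact h.elim
    | cons b l =>
      rcases h with ⟨-, rfl⟩ | h
      · simp
      · exact List.mem_of_mem_tail (ih h)

theorem Consec.mem_dropLast {l : List V} {i j : V} (h : Consec l i j) : i ∈ l.dropLast := by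
  induction l with
  | nil => exact h.elim
  | cons a l ih =>
    cases l with
    | nil => exact h.elim
    | cons b l =>
      rcases h with ⟨rfl, -⟩ | h
      · simp
      · simp [ih h]

theorem exists_consec_of_mem {a j : V} {l : List V} (h : j ∈ l) : ∃ i, Consec (a :: l) i j := by
  induction l generalizing a with
  | nil => simp at h
  | cons b l ih =>
    rcases List.mem_cons.1 h with rfl | h
    · exact ⟨a, .inl ⟨rfl, rfl⟩⟩
    · obtain ⟨i, hi⟩ := ih (a := b) h
      exact ⟨i, .inr hi⟩

/-- Only the tail is required to be duplicate-free: in a closed curve the first vertex `a` reappears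
at the end. -/
theorem Consec.left_unique {a i i' j : V} {l : List V} (hl : l.Nodup) (h : Consec (a :: l) i j)
    (h' : Consec (a :: l) i' j) : i = i' := by
  induction l generalizing a with
  | nil => exact h.elim
  | cons b l ih =>
    rw [List.nodup_cons] at hl
    rcases h with ⟨rfl, rfl⟩ | h <;> rcases h' with ⟨rfl, h2⟩ | h'
    · rfl
    · exact (hl.1 h'.mem_tail).elim
    · exact (hl.1 (h2 ▸ h.mem_tail)).elim
    · exact ih hl.2 h h'

/-- A property of consecutive pairs that propagates along the list. -/
theorem Consec.propagate {P : V → V → Prop} {a b : V} {l : List V} (h0 : P a b)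
    (h : ∀ i j k, Consec (a :: b :: l) i j → Consec (b :: l) j k → P i j → P j k) {i j : V}
    (hij : Consec (a :: b :: l) i j) : P i j := by
  induction l generalizing a b with
  | nil =>
    rcases hij with ⟨rfl, rfl⟩ | h
    · exact h0
    · exact h.elim
  | cons c l ih =>
    rcases hij with ⟨rfl, rfl⟩ | hij
    · exact h0
    · exact ih (h a b c (.inl ⟨rfl, rfl⟩) (.inl ⟨rfl, rfl⟩) h0)
        (fun i j k h1 h2 => h i j k (.inr h1) (.inr h2)) hij

end Consecutive

/-! ### Triangulated spheres, regions and disks. -/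

/-- A triangulation of the sphere, described by its oriented triangles `Tri a b c`. The triangles
at a vertex form a cycle, and cycles of the graph separate. -/
structure SphereTriangulation {V : Type*} [Fintype V] (G : SimpleGraph V) where
  Tri : V → V → V → Prop
  adj : ∀ {a b c}, Tri a b c → G.Adj a b
  rot : ∀ {a b c}, Tri a b c → Tri b c a
  exists_tri : ∀ {a b}, G.Adj a b → ∃ c, Tri a b c
  unique : ∀ {a b c d}, Tri a b c → Tri a b d → c = d
  link : ∀ (v : V) (X : Set V), (∀ b c, b ∈ X → Tri v c b → c ∈ X) →
    ∀ b ∈ X, G.Adj v b → ∀ c, G.Adj v c → c ∈ X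
  connected : G.Connected
  separates : ∀ g : V → V → ZMod 2, (∀ a b, g a b = g b a) → (∀ a b, g a b ≠ 0 → G.Adj a b) →
    (∀ a, ∑ b, g a b = 0) → ∃ S : Set (V × V),
      (∀ a b c, Tri a b c → (a, b) ∈ S → (b, c) ∈ S) ∧ (∀ a b, (a, b) ∈ S → G.Adj a b) ∧
      ∀ a b, G.Adj a b → (g a b ≠ 0 ↔ ¬ ((a, b) ∈ S ↔ (b, a) ∈ S))

namespace SphereTriangulation

variable {V : Type*} [Fintype V] {G : SimpleGraph V} (𝒯 : SphereTriangulation G)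

/-- A set of triangles, given as the set of the darts on their boundaries. -/
structure IsRegion (S : Set (V × V)) : Prop where
  tri : ∀ {a b c}, 𝒯.Tri a b c → (a, b) ∈ S → (b, c) ∈ S
  adj : ∀ {a b}, (a, b) ∈ S → G.Adj a b

/-- The dart `(a, b)` has the region on its left side only. -/
def Bd (S : Set (V × V)) (a b : V) : Prop := (a, b) ∈ S ∧ (b, a) ∉ S

open Classical in
/-- The edges of the triangles of a region. -/
noncomputable def edges (S : Set (V × V)) : Finset (Sym2 V) :=
  Finset.univ.filter fun e => ∃ a b, (a, b) ∈ S ∧ e = s(a, b)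

theorem mem_edges {S : Set (V × V)} {e : Sym2 V} :
    e ∈ edges S ↔ ∃ a b, (a, b) ∈ S ∧ e = s(a, b) := by simp [edges]

theorem mk_mem_edges {S : Set (V × V)} {a b : V} :
    s(a, b) ∈ edges S ↔ (a, b) ∈ S ∨ (b, a) ∈ S := by
  rw [mem_edges]
  constructor
  · rintro ⟨i, j, h, he⟩
    rcases Sym2.eq_iff.1 he with ⟨rfl, rfl⟩ | ⟨rfl, rfl⟩
    · exact .inl h
    · exact .inr h
  · rintro (h | h)
    · exact ⟨a, b, h, rfl⟩
    · exact ⟨b, a, h, Sym2.eq_swap⟩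

variable {𝒯}

namespace IsRegion

variable {S A : Set (V × V)} (hS : 𝒯.IsRegion S)
include hS

theorem edges_subset {e : Sym2 V} (he : e ∈ edges S) : e ∈ G.edgeSet := by
  obtain ⟨a, b, h, rfl⟩ := mem_edges.1 he
  exact hS.adj h

theorem inter (hA : 𝒯.IsRegion A) : 𝒯.IsRegion (S ∩ A) :=
  ⟨fun ht h => ⟨hS.tri ht h.1, hA.tri ht h.2⟩, fun h => hS.adj h.1⟩

theorem diff (hA : 𝒯.IsRegion A) : 𝒯.IsRegion (S \ A) :=
  ⟨fun ht h => ⟨hS.tri ht h.1, fun h' => h.2 (hA.tri (𝒯.rot ht) h' |> hA.tri (𝒯.rot (𝒯.rot ht)))⟩,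
    fun h => hS.adj h.1⟩

theorem exists_out {z c : V} (h : (c, z) ∈ S) : ∃ d, (z, d) ∈ S := by
  obtain ⟨d, hd⟩ := 𝒯.exists_tri (hS.adj h)
  exact ⟨d, hS.tri hd h⟩

/-- A vertex of a region that does not lie on its boundary is surrounded by the region. -/
theorem mem_of_not_bd {z b c : V} (hz : ∀ d, ¬ Bd S z d) (hb : (z, b) ∈ S) (hc : G.Adj z c) :
    (z, c) ∈ S := by
  refine 𝒯.link z {d | (z, d) ∈ S} ?_ b hb (hS.adj hb) c hc
  intro d e hd ht
  have : (d, z) ∈ S := by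
    by_contra h
    exact hz d ⟨hd, h⟩
  exact hS.tri (𝒯.rot (𝒯.rot ht)) this

/-- A region without boundary surrounds each vertex it touches, hence touches all neighbours of that
vertex, and connectedness does the rest. -/
theorem eq_univ_of_not_bd (h : ∀ a b, ¬ Bd S a b) {a b : V} (hab : (a, b) ∈ S) {c d : V}
    (hcd : G.Adj c d) : (c, d) ∈ S := by
  suffices hw : ∀ z, ∃ e, (z, e) ∈ S by
    obtain ⟨e, he⟩ := hw c
    exact hS.mem_of_not_bd (h c) he hcd
  intro z
  obtain ⟨w⟩ := 𝒯.connected.preconnected a z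
  revert b
  induction w with
  | nil => exact fun {b} hab => ⟨b, hab⟩
  | @cons u _ _ hadj _ ih =>
    intro b hab
    have h1 := hS.mem_of_not_bd (h _) hab hadj
    refine ih (b := u) ?_
    by_contra h2
    exact h _ _ ⟨h1, h2⟩

/-- Every vertex has as many outgoing as incoming boundary darts. -/
theorem ncard_bd_out_eq (z : V) : {b | Bd S z b}.ncard = {b | Bd S b z}.ncard := by
  have hcard : {b | (z, b) ∈ S}.ncard = {b | (b, z) ∈ S}.ncard := by
    -- Inside each triangle `z b c` of the region the outgoing dart `zb` is matched with the
    -- incoming dart `cz`. Discarding the edges whose two darts both lie in `S` leaves the boundary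
    -- darts.
    choose f hf using fun b : {b // G.Adj z b} => 𝒯.exists_tri b.2
    refine Set.ncard_congr (fun b hb => f ⟨b, hS.adj hb⟩) ?_ ?_ ?_
    · intro b hb
      exact hS.tri (𝒯.rot (hf ⟨b, hS.adj hb⟩)) (hS.tri (hf ⟨b, hS.adj hb⟩) hb)
    · intro b c hb hc hbc
      have h1 := 𝒯.rot (𝒯.rot (hf ⟨b, hS.adj hb⟩))
      have h2 := 𝒯.rot (𝒯.rot (hf ⟨c, hS.adj hc⟩))
      simp only at h1 h2 hbc
      rw [hbc] at h1
      exact 𝒯.unique h1 h2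
    · intro b hb
      obtain ⟨c, hc⟩ := 𝒯.exists_tri (hS.adj hb)
      have hzc : (z, c) ∈ S := hS.tri hc hb
      exact ⟨c, hzc, 𝒯.unique (hf _) (𝒯.rot hc)⟩
  have h1 : {b | Bd S z b} = {b | (z, b) ∈ S} \ {b | (b, z) ∈ S} := rfl
  have h2 : {b | Bd S b z} = {b | (b, z) ∈ S} \ {b | (z, b) ∈ S} := rfl
  have e1 := Set.ncard_sdiff_add_ncard {b | (z, b) ∈ S} {b | (b, z) ∈ S} (Set.toFinite _)
    (Set.toFinite _)
  have e2 := Set.ncard_sdiff_add_ncard {b | (b, z) ∈ S} {b | (z, b) ∈ S} (Set.toFinite _)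
    (Set.toFinite _)
  rw [Set.union_comm] at e2
  rw [h1, h2]
  omega

theorem exists_bd_out {z b : V} (h : Bd S b z) : ∃ c, Bd S z c := by
  have h1 : 0 < {b | Bd S b z}.ncard := (Set.ncard_pos (Set.toFinite _)).2 ⟨b, h⟩
  rw [← hS.ncard_bd_out_eq] at h1
  exact (Set.ncard_pos (Set.toFinite _)).1 h1

theorem exists_bd_in {z b : V} (h : Bd S z b) : ∃ c, Bd S c z := by
  have h1 : 0 < {b | Bd S z b}.ncard := (Set.ncard_pos (Set.toFinite _)).2 ⟨b, h⟩
  rw [hS.ncard_bd_out_eq] at h1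
  exact (Set.ncard_pos (Set.toFinite _)).1 h1

theorem bd_out_unique {z a : V} (h : ∀ b, Bd S b z → b = a) {c d : V} (hc : Bd S z c)
    (hd : Bd S z d) : c = d := by
  have h1 : {b | Bd S z b}.ncard ≤ 1 := by
    rw [hS.ncard_bd_out_eq]
    refine (Set.ncard_le_one (Set.toFinite _)).2 fun x hx y hy => (h x hx).trans (h y hy).symm
  exact (Set.ncard_le_one (Set.toFinite _)).1 h1 c hc d hd

end IsRegion

variable (𝒯) in
/-- The boundary of the region `S` is the simple closed curve with the vertex list `p`, which
ends in `y`. -/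
structure IsDisk (S : Set (V × V)) (y : V) (p : List V) : Prop where
  region : 𝒯.IsRegion S
  nodup : p.Nodup
  last : p.getLast? = some y
  bd_iff : ∀ a b, Bd S a b ↔ Consec (y :: p) a b

namespace IsDisk

variable {S S₁ S₂ : Set (V × V)} {y y₁ y₂ : V} {p p₁ p₂ : List V}

theorem mem_of_bd_right (h : 𝒯.IsDisk S y p) {a b : V} (hab : Bd S a b) : b ∈ p :=
  ((h.bd_iff a b).1 hab).mem_tail

theorem mem_of_bd_left (h : 𝒯.IsDisk S y p) {a b : V} (hab : Bd S a b) : a ∈ p := by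
  obtain ⟨c, hc⟩ := h.region.exists_bd_in hab
  exact h.mem_of_bd_right hc

theorem exists_bd (h : 𝒯.IsDisk S y p) {b : V} (hb : b ∈ p) : ∃ a, Bd S a b := by
  obtain ⟨a, ha⟩ := exists_consec_of_mem (a := y) hb
  exact ⟨a, (h.bd_iff a b).2 ha⟩

theorem exists_mem_edges (h : 𝒯.IsDisk S y p) {b : V} (hb : b ∈ p) : ∃ e ∈ edges S, b ∈ e := by
  obtain ⟨a, ha⟩ := h.exists_bd hb
  exact ⟨s(a, b), mk_mem_edges.2 (.inl ha.1), by simp⟩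

theorem exists_out (hS : 𝒯.IsRegion S) {z : V} {e : Sym2 V} (he : e ∈ edges S) (hz : z ∈ e) :
    ∃ b, (z, b) ∈ S := by
  obtain ⟨b, rfl⟩ := Sym2.mem_iff_exists.1 hz
  rcases mk_mem_edges.1 he with h | h
  · exact ⟨b, h⟩
  · exact hS.exists_out h

/-- A common vertex of two disjoint disks lies on the boundary of the first. -/
theorem mem_of_mem_edges (h₁ : 𝒯.IsDisk S₁ y₁ p₁) (h₂ : 𝒯.IsRegion S₂)
    (hd : Disjoint S₁ S₂) {z : V} {e₁ e₂ : Sym2 V} (he₁ : e₁ ∈ edges S₁) (hz₁ : z ∈ e₁)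
    (he₂ : e₂ ∈ edges S₂) (hz₂ : z ∈ e₂) : z ∈ p₁ := by
  obtain ⟨b, hb⟩ := exists_out h₁.region he₁ hz₁
  obtain ⟨c, hc⟩ := exists_out h₂ he₂ hz₂
  by_contra hz
  exact Set.disjoint_left.1 hd
    (h₁.region.mem_of_not_bd (fun d hd => hz (h₁.mem_of_bd_left hd)) hb (h₂.adj hc)) hc

end IsDisk

end SphereTriangulation

/-! ### Removing triangles and boundary vertices from a disk. -/

namespace SphereTriangulation

/-- The darts of one triangle. -/
def triDarts {V : Type*} (a b c : V) : Set (V × V) := {(a, b), (b, c), (c, a)}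

theorem mem_triDarts {V : Type*} {a b c i j : V} : (i, j) ∈ triDarts a b c ↔
    (i = a ∧ j = b) ∨ (i = b ∧ j = c) ∨ (i = c ∧ j = a) := by
  simp [triDarts]

variable {V : Type*} [Fintype V] {G : SimpleGraph V} {𝒯 : SphereTriangulation G}

theorem isRegion_triDarts {a b c : V} (h : 𝒯.Tri a b c) : 𝒯.IsRegion (triDarts a b c) := by
  have h1 := 𝒯.rot h
  have h2 := 𝒯.rot h1
  constructor
  · intro i j k ht hij
    rw [mem_triDarts] at hij ⊢
    rcases hij with ⟨rfl, rfl⟩ | ⟨rfl, rfl⟩ | ⟨rfl, rfl⟩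
    · simp [𝒯.unique ht h]
    · simp [𝒯.unique ht h1]
    · simp [𝒯.unique ht h2]
  · intro i j hij
    rw [mem_triDarts] at hij
    rcases hij with ⟨rfl, rfl⟩ | ⟨rfl, rfl⟩ | ⟨rfl, rfl⟩
    exacts [𝒯.adj h, 𝒯.adj h1, 𝒯.adj h2]

theorem edges_eq_empty : edges (∅ : Set (V × V)) = ∅ := by
  ext e; simp [mem_edges]

theorem edges_mono {S S' : Set (V × V)} (h : S ⊆ S') {e : Sym2 V} (he : e ∈ edges S) :
    e ∈ edges S' := by
  obtain ⟨i, j, hij, rfl⟩ := mem_edges.1 he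
  exact mem_edges.2 ⟨i, j, h hij, rfl⟩

namespace IsDisk

variable {S : Set (V × V)} {y : V}

theorem mem_of_tri (hS : 𝒯.IsRegion S) {a b c : V} (h : 𝒯.Tri a b c) (hab : (a, b) ∈ S) :
    triDarts a b c ⊆ S := by
  rintro ⟨i, j⟩ hij
  rw [mem_triDarts] at hij
  have h1 := hS.tri h hab
  rcases hij with ⟨rfl, rfl⟩ | ⟨rfl, rfl⟩ | ⟨rfl, rfl⟩
  exacts [hab, h1, hS.tri (𝒯.rot h) h1]

/-- Removing the triangle at a boundary edge whose third vertex is an interior vertex. -/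
theorem remove_triangle_inner {pre l : List V} {a v u : V}
    (hD : 𝒯.IsDisk S y (pre ++ a :: v :: l)) (ht : 𝒯.Tri a v u)
    (hu : u ∉ pre ++ a :: v :: l) :
    𝒯.IsDisk (S \ triDarts a v u) y (pre ++ a :: u :: v :: l) ∧
    ∀ e, e ∈ edges S ↔ e ∈ edges (S \ triDarts a v u) ∨ e = s(v, a) := by
  have hnd := hD.nodup
  have hav : Bd S a v := by
    rw [hD.bd_iff, ← List.cons_append, consec_append_cons]; simp
  have hsub := mem_of_tri hD.region ht hav.1
  have hvu : (v, u) ∈ S := hsub (by simp [mem_triDarts])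
  have hua : (u, a) ∈ S := hsub (by simp [mem_triDarts])
  have huv : (u, v) ∈ S := by
    by_contra h
    exact hu (hD.mem_of_bd_right (a := v) ⟨hvu, h⟩)
  have hau : (a, u) ∈ S := by
    by_contra h
    exact hu (hD.mem_of_bd_left (b := a) ⟨hua, h⟩)
  have hne1 : u ≠ a := by rintro rfl; simp at hu
  have hne2 : u ≠ v := by rintro rfl; simp at hu
  have hne3 : a ≠ v := by
    rintro rfl
    simp [List.nodup_append] at hnd
  refine ⟨⟨hD.region.diff (isRegion_triDarts ht), ?_, ?_, ?_⟩, ?_⟩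
  · have hp : (pre ++ a :: u :: v :: l).Perm (u :: (pre ++ a :: v :: l)) := by
      simpa using (List.perm_middle (l₁ := pre ++ [a]) (a := u) (l₂ := v :: l))
    rw [hp.nodup_iff, List.nodup_cons]
    exact ⟨hu, hnd⟩
  · simpa [List.getLast?_append] using hD.last
  · intro i j
    have key : Bd (S \ triDarts a v u) i j ↔ (Bd S i j ∧ ¬ (i = a ∧ j = v)) ∨
        (i = a ∧ j = u) ∨ (i = u ∧ j = v) := by
      have hb1 : ∀ {b}, ¬ Bd S b u := fun h => hu (hD.mem_of_bd_right h)
      have hb2 : ∀ {b}, ¬ Bd S u b := fun h => hu (hD.mem_of_bd_left h)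
      constructor
      · rintro ⟨⟨h1, h2⟩, h3⟩
        rw [mem_triDarts] at h2
        by_cases hji : (j, i) ∈ S
        · have h4 : (j, i) ∈ triDarts a v u := by
            by_contra h4; exact h3 ⟨hji, h4⟩
          rw [mem_triDarts] at h4
          rcases h4 with ⟨rfl, rfl⟩ | ⟨rfl, rfl⟩ | ⟨rfl, rfl⟩
          · exact (hav.2 h1).elim
          · simp
          · simp
        · exact .inl ⟨⟨h1, hji⟩, by grind⟩
      · rintro (⟨h1, h2⟩ | ⟨rfl, rfl⟩ | ⟨rfl, rfl⟩)
        · refine ⟨⟨h1.1, ?_⟩, fun h => h1.2 h.1⟩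
          rw [mem_triDarts]
          rintro (h | ⟨rfl, rfl⟩ | ⟨rfl, rfl⟩)
          · exact h2 h
          · exact hb1 h1
          · exact hb2 h1
        · refine ⟨⟨hau, ?_⟩, fun h => h.2 (by simp [mem_triDarts])⟩
          simp [mem_triDarts, hne1, hne2, hne3]
        · refine ⟨⟨huv, ?_⟩, fun h => h.2 (by simp [mem_triDarts])⟩
          simp [mem_triDarts, hne1, hne2, hne3.symm]
    rw [key, hD.bd_iff, ← List.cons_append, ← List.cons_append, consec_append_cons,
      consec_append_cons _ a (u :: _)]
    have h1 : Consec (y :: pre ++ [a]) i j → j ≠ v := by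
      rintro h rfl
      have := h.mem_tail
      simp only [List.cons_append, List.tail_cons] at this
      rw [← List.singleton_append, ← List.append_assoc, List.nodup_append] at hnd
      exact hnd.2.2 _ this _ (by simp) rfl
    have h2 : Consec (v :: l) i j → j ≠ v := by
      rintro h rfl
      have := h.mem_tail
      rw [← List.singleton_append, ← List.append_assoc, List.nodup_append] at hnd
      exact (List.nodup_cons.1 hnd.2.1).1 this
    simp only [consec_cons_cons]
    grind
  · intro e
    constructor
    · intro he
      obtain ⟨i, j, hij, rfl⟩ := mem_edges.1 he
      by_cases ht : (i, j) ∈ triDarts a v u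
      · rw [mem_triDarts] at ht
        rcases ht with ⟨rfl, rfl⟩ | ⟨rfl, rfl⟩ | ⟨rfl, rfl⟩
        · exact .inr Sym2.eq_swap
        · exact .inl (mk_mem_edges.2 (.inr ⟨huv, by simp [mem_triDarts, hne1, hne2, hne3.symm]⟩))
        · exact .inl (mk_mem_edges.2 (.inr ⟨hau, by simp [mem_triDarts, hne1, hne2, hne3]⟩))
      · exact .inl (mk_mem_edges.2 (.inl ⟨hij, ht⟩))
    · rintro (h | rfl)
      · exact edges_mono Set.sdiff_subset h
      · exact mk_mem_edges.2 (.inr hav.1)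

/-- Removing the triangle on two consecutive boundary edges. -/
theorem remove_triangle_outer {pre l : List V} {a v w : V}
    (hD : 𝒯.IsDisk S y (pre ++ a :: v :: w :: l)) (ht : 𝒯.Tri a v w) (haw : (a, w) ∈ S) :
    𝒯.IsDisk (S \ triDarts a v w) y (pre ++ a :: w :: l) ∧
    (∀ e, e ∈ edges S ↔ e ∈ edges (S \ triDarts a v w) ∨ e = s(v, a) ∨ e = s(v, w)) ∧
    ∀ z, s(v, z) ∉ edges (S \ triDarts a v w) := by
  have hnd := hD.nodup
  have hav : Bd S a v := by
    rw [hD.bd_iff, ← List.cons_append, consec_append_cons]; simp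
  have hvw : Bd S v w := by
    rw [hD.bd_iff, ← List.cons_append, consec_append_cons]; simp
  have hsub := mem_of_tri hD.region ht hav.1
  have hwa : (w, a) ∈ S := hsub (by simp [mem_triDarts])
  have hne : a ≠ v ∧ a ≠ w ∧ v ≠ w ∧ v ∉ pre ∧ w ∉ pre ∧ v ∉ l ∧ w ∉ l := by
    simp only [List.nodup_append, List.nodup_cons, List.mem_cons] at hnd
    grind
  obtain ⟨hne1, hne2, hne3, hv1, hw1, hv2, hw2⟩ := hne
  have hR : 𝒯.IsRegion (S \ triDarts a v w) := hD.region.diff (isRegion_triDarts ht)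
  have hbd : ∀ i j, Bd (S \ triDarts a v w) i j ↔ Consec (y :: (pre ++ a :: w :: l)) i j := by
    intro i j
    have key : Bd (S \ triDarts a v w) i j ↔
        (Bd S i j ∧ ¬ (i = a ∧ j = v) ∧ ¬ (i = v ∧ j = w)) ∨ (i = a ∧ j = w) := by
      constructor
      · rintro ⟨⟨h1, h2⟩, h3⟩
        rw [mem_triDarts] at h2
        by_cases hji : (j, i) ∈ S
        · have h4 : (j, i) ∈ triDarts a v w := by
            by_contra h4; exact h3 ⟨hji, h4⟩
          rw [mem_triDarts] at h4
          rcases h4 with ⟨rfl, rfl⟩ | ⟨rfl, rfl⟩ | ⟨rfl, rfl⟩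
          · exact (hav.2 h1).elim
          · exact (hvw.2 h1).elim
          · simp
        · exact .inl ⟨⟨h1, hji⟩, by grind⟩
      · rintro (⟨h1, h2, h3⟩ | ⟨rfl, rfl⟩)
        · refine ⟨⟨h1.1, ?_⟩, fun h => h1.2 h.1⟩
          rw [mem_triDarts]
          rintro (h | h | ⟨rfl, rfl⟩)
          · exact h2 h
          · exact h3 h
          · exact h1.2 haw
        · refine ⟨⟨haw, ?_⟩, fun h => h.2 (by simp [mem_triDarts])⟩
          simp [mem_triDarts, hne1, hne2, hne3.symm]
    rw [key, hD.bd_iff, ← List.cons_append, ← List.cons_append, consec_append_cons,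
      consec_append_cons _ a (w :: _)]
    have h1 : Consec (y :: pre ++ [a]) i j → j ≠ v ∧ j ≠ w := by
      intro h
      have := h.mem_tail
      simp only [List.cons_append, List.tail_cons, List.mem_append, List.mem_singleton] at this
      grind
    have h2 : Consec (w :: l) i j → j ≠ v ∧ j ≠ w := by
      intro h
      have := h.mem_tail
      simp only [List.tail_cons] at this
      grind
    simp only [consec_cons_cons]
    grind
  refine ⟨⟨hR, ?_, ?_, hbd⟩, ?_, ?_⟩
  · refine hnd.sublist ?_
    simp
  · simpa [List.getLast?_append] using hD.last
  · intro e
    constructor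
    · intro he
      obtain ⟨i, j, hij, rfl⟩ := mem_edges.1 he
      by_cases ht : (i, j) ∈ triDarts a v w
      · rw [mem_triDarts] at ht
        rcases ht with ⟨rfl, rfl⟩ | ⟨rfl, rfl⟩ | ⟨rfl, rfl⟩
        · exact .inr (.inl Sym2.eq_swap)
        · exact .inr (.inr rfl)
        · exact .inl (mk_mem_edges.2 (.inr ⟨haw, by simp [mem_triDarts, hne1, hne2, hne3.symm]⟩))
      · exact .inl (mk_mem_edges.2 (.inl ⟨hij, ht⟩))
    · rintro (h | rfl | rfl)
      · exact edges_mono Set.sdiff_subset h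
      · exact mk_mem_edges.2 (.inr hav.1)
      · exact mk_mem_edges.2 (.inl hvw.1)
  · intro z hz
    obtain ⟨b, hb⟩ := exists_out hR hz (by simp : v ∈ s(v, z))
    -- Since `v` is off the new boundary, any remaining triangle at `v` would force the region to
    -- surround `v`, although `S` does not contain the dart `va`.
    have hva := hR.mem_of_not_bd (fun d hd => ?_) hb (hD.region.adj hav.1).symm
    · exact hav.2 hva.1
    · obtain ⟨c, hc⟩ := hR.exists_bd_in hd
      have := ((hbd _ _).1 hc).mem_tail
      simp only [List.tail_cons, List.mem_append, List.mem_cons] at this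
      grind

/-- Removing all the triangles at a boundary vertex `v` without chords. -/
theorem remove_vertex {a v w : V} {pre l : List V}
    (hD : 𝒯.IsDisk S y (pre ++ a :: v :: w :: l))
    (hch : ∀ c ∈ pre ++ a :: v :: w :: l, (v, c) ∈ S → (c, v) ∉ S)
    (hdeg : 𝒯.Tri a v w → (a, w) ∈ S) :
    ∃ (us : List V) (S' : Set (V × V)), S' ⊂ S ∧ 𝒯.IsDisk S' y (pre ++ a :: us ++ w :: l) ∧
      v ∉ us ∧ (∀ u ∈ us, u ∉ pre ++ a :: v :: w :: l) ∧
      (∀ e, e ∈ edges S ↔ e ∈ edges S' ∨ ∃ z ∈ a :: w :: us, e = s(v, z)) ∧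
      ∀ z, s(v, z) ∉ edges S' := by
  induction hn : S.ncard using Nat.strong_induction_on generalizing S pre a with
  | _ n ih =>
  have hav : Bd S a v := by
    rw [hD.bd_iff, ← List.cons_append, consec_append_cons]; simp
  obtain ⟨u, ht⟩ := 𝒯.exists_tri (hD.region.adj hav.1)
  have hsub := mem_of_tri hD.region ht hav.1
  have hss : S \ triDarts a v u ⊂ S :=
    ⟨Set.sdiff_subset, fun h => (h hav.1).2 (by simp [mem_triDarts])⟩
  -- The triangles at `v` are peeled off as a fan starting at `a`: the third vertex `u` is either
  -- `w`, and the fan is complete, or an inner vertex that takes over the role of `a`.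
  by_cases huw : u = w
  · subst huw
    obtain ⟨h1, h2, h3⟩ := hD.remove_triangle_outer ht (hdeg ht)
    refine ⟨[], _, hss, by simpa using h1, by simp, by simp, ?_, h3⟩
    simpa using h2
  · have hvu : (v, u) ∈ S := hsub (by simp [mem_triDarts])
    have hu : u ∉ pre ++ a :: v :: w :: l := by
      intro hu
      have hb : Bd S v u := ⟨hvu, hch u hu hvu⟩
      have hb' : Bd S v w := by
        rw [hD.bd_iff, ← List.cons_append, consec_append_cons]; simp
      refine huw (hD.region.bd_out_unique (a := a) (fun b hb => ?_) hb hb')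
      exact Consec.left_unique hD.nodup ((hD.bd_iff _ _).1 hb) ((hD.bd_iff _ _).1 hav)
    obtain ⟨h1, h2⟩ := hD.remove_triangle_inner ht hu
    have hlt : (S \ triDarts a v u).ncard < n := hn ▸ Set.ncard_lt_ncard hss (Set.toFinite _)
    have hassoc : pre ++ a :: u :: v :: w :: l = (pre ++ [a]) ++ u :: v :: w :: l := by simp
    rw [hassoc] at h1
    have hch' : ∀ c ∈ (pre ++ [a]) ++ u :: v :: w :: l, (v, c) ∈ S \ triDarts a v u →
        (c, v) ∉ S \ triDarts a v u := by
      intro c hc hvc hcv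
      rw [← hassoc] at hc
      by_cases hcu : c = u
      · subst hcu
        exact hvc.2 (by simp [mem_triDarts])
      · refine hch c ?_ hvc.1 hcv.1
        simp only [List.mem_append, List.mem_cons] at hc ⊢
        tauto
    -- Otherwise `wu` would be a boundary dart; but the boundary enters `u` from `a`, and `w ≠ a`.
    have hdeg' : 𝒯.Tri u v w → (u, w) ∈ S \ triDarts a v u := by
      intro ht'
      by_contra hn
      have hwu : Bd (S \ triDarts a v u) w u := by
        refine ⟨?_, hn⟩
        have hb : (u, v) ∈ S \ triDarts a v u := by
          have : Bd (S \ triDarts a v u) u v := by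
            rw [h1.bd_iff, ← List.cons_append, consec_append_cons]; simp
          exact this.1
        exact h1.region.tri (𝒯.rot ht') (h1.region.tri ht' hb)
      have hau : Bd (S \ triDarts a v u) a u := by
        rw [h1.bd_iff, ← hassoc, ← List.cons_append, consec_append_cons]; simp
      have : w = a := Consec.left_unique h1.nodup ((h1.bd_iff _ _).1 hwu) ((h1.bd_iff _ _).1 hau)
      subst this
      have := hD.nodup
      simp [List.nodup_append] at this
    obtain ⟨us, S', i1, i2, i3, i4, i5, i6⟩ := ih _ hlt h1 hch' hdeg' rfl
    refine ⟨u :: us, S', i1.trans hss, by simpa using i2, ?_, ?_, ?_, i6⟩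
    · rw [List.mem_cons, not_or]
      exact ⟨by rintro rfl; simp at hu, i3⟩
    · intro z hz
      rcases List.mem_cons.1 hz with rfl | hz
      · exact hu
      · have := i4 z hz
        simp only [List.mem_append, List.mem_cons] at this ⊢
        grind
    · intro e
      rw [h2, i5]
      simp only [List.mem_cons, or_assoc, exists_eq_or_imp]
      grind

end IsDisk

end SphereTriangulation

/-! ### Closed walks modulo two. -/

section ConsecCount

variable {V : Type*}

open Classical in
/-- The number modulo two of occurrences of `j` immediately after `i` in a list. -/
noncomputable def consecCount : List V → V → V → ZMod 2
  | a :: b :: l, i, j => (if i = a ∧ j = b then 1 else 0) + consecCount (b :: l) i j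
  | _, _, _ => 0

theorem consecCount_eq_zero {l : List V} {i j : V} (h : ¬ Consec l i j) :
    consecCount l i j = 0 := by
  induction l with
  | nil => rfl
  | cons a l ih =>
    cases l with
    | nil => rfl
    | cons b l =>
      rw [consec_cons_cons, not_or] at h
      rw [consecCount, if_neg h.1, ih h.2, add_zero]

open Classical in
-- A walk leaves each intermediate vertex as often as it enters it, so modulo two only the endpoints
-- survive. For a closed walk these cancel too.
theorem sum_consecCount [Fintype V] (a y : V) (l : List V) (h : (a :: l).getLast? = some y)
    (z : V) : ∑ b, (consecCount (a :: l) z b + consecCount (a :: l) b z) =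
      (if z = a then 1 else 0) + (if z = y then 1 else 0) := by
  induction l generalizing a with
  | nil =>
    simp only [List.getLast?_singleton, Option.some.injEq] at h
    subst h
    simp [consecCount, CharTwo.add_self_eq_zero]
  | cons b l ih =>
    rw [List.getLast?_cons_cons] at h
    have h1 : ∑ x : V, (if z = a ∧ x = b then (1 : ZMod 2) else 0) = if z = a then 1 else 0 := by
      by_cases hz : z = a <;> simp [hz]
    have h2 : ∑ x : V, (if x = a ∧ z = b then (1 : ZMod 2) else 0) = if z = b then 1 else 0 := by
      by_cases hz : z = b <;> simp [hz]
    have := ih b h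
    simp only [consecCount]
    rw [Finset.sum_congr rfl fun x _ => show _ =
      ((if z = a ∧ x = b then (1 : ZMod 2) else 0) + (if x = a ∧ z = b then (1 : ZMod 2) else 0)) +
      (consecCount (b :: l) z x + consecCount (b :: l) x z) by ring, Finset.sum_add_distrib, this,
      Finset.sum_add_distrib, h1, h2]
    have h3 := CharTwo.add_self_eq_zero (if z = b then (1 : ZMod 2) else 0)
    linear_combination h3

end ConsecCount

theorem getLast?_append_cons {α : Type*} (l : List α) (a : α) (m : List α) :
    (l ++ a :: m).getLast? = (a :: m).getLast? := by
  rw [List.getLast?_append, List.getLast?_eq_some_getLast (List.cons_ne_nil a m), Option.some_or]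

/-! ### Splitting a disk along a chord. -/

namespace SphereTriangulation

variable {V : Type*} [Fintype V] {G : SimpleGraph V} {𝒯 : SphereTriangulation G}

/-- Every closed walk is the boundary of a region modulo two. -/
theorem exists_region_of_closed_list (𝒯 : SphereTriangulation G) {a : V} {l : List V}
    (hl : l.getLast? = some a) (hadj : ∀ i j, Consec (a :: l) i j → G.Adj i j) :
    ∃ R, 𝒯.IsRegion R ∧ ∀ i j, G.Adj i j →
      (consecCount (a :: l) i j + consecCount (a :: l) j i ≠ 0 ↔
        ¬ ((i, j) ∈ R ↔ (j, i) ∈ R)) := by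
  have h1 : ∀ i j, consecCount (a :: l) i j + consecCount (a :: l) j i ≠ 0 → G.Adj i j := by
    intro i j hij
    by_contra hn
    refine hij ?_
    rw [consecCount_eq_zero fun h => hn (hadj _ _ h),
      consecCount_eq_zero fun h => hn (hadj _ _ h).symm, add_zero]
  have h2 : ∀ z, ∑ b, (consecCount (a :: l) z b + consecCount (a :: l) b z) = 0 := by
    intro z
    rw [sum_consecCount a a l (by cases l <;> simp_all)]
    exact CharTwo.add_self_eq_zero _
  obtain ⟨R, h3, h4, h5⟩ := 𝒯.separates
    (fun i j => consecCount (a :: l) i j + consecCount (a :: l) j i)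
    (fun i j => add_comm _ _) h1 h2
  exact ⟨R, ⟨@h3, @h4⟩, h5⟩

namespace IsDisk

variable {S : Set (V × V)} {y : V}

/-- Splitting a disk along a chord `vc`. -/
theorem split_chord {x v w c : V} {l₀ l₂ : List V}
    (hD : 𝒯.IsDisk S y (x :: v :: w :: l₀ ++ c :: l₂)) (hvc : (v, c) ∈ S) (hcv : (c, v) ∈ S) :
    ∃ A, A ⊂ S ∧ S \ A ⊂ S ∧ 𝒯.IsDisk A c (v :: w :: l₀ ++ [c]) ∧
      𝒯.IsDisk (S \ A) y (x :: v :: c :: l₂) := by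
  have hnd := hD.nodup
  have hlast := hD.last
  rw [getLast?_append_cons] at hlast
  have hbd : ∀ i j, Bd S i j ↔ (i = y ∧ j = x) ∨ (i = x ∧ j = v) ∨
      Consec (v :: w :: l₀ ++ [c]) i j ∨ Consec (c :: l₂) i j := by
    intro i j
    rw [hD.bd_iff, ← List.cons_append, consec_append_cons]
    simp only [List.cons_append, consec_cons_cons, or_assoc]
  have hadj : ∀ i j, Consec (c :: (v :: w :: l₀ ++ [c])) i j → G.Adj i j := by
    rintro i j (⟨rfl, rfl⟩ | h)
    · exact hD.region.adj hcv
    · exact hD.region.adj ((hbd i j).2 (.inr (.inr (.inl h)))).1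
  obtain ⟨R, hR, hRg⟩ := 𝒯.exists_region_of_closed_list (a := c) (l := v :: w :: l₀ ++ [c])
    (getLast?_append_cons _ _ _) hadj
  have hnc : ∀ i j, Consec (v :: w :: l₀ ++ [c]) i j → (j, i) ∉ S := fun i j h =>
    ((hbd i j).2 (.inr (.inr (.inl h)))).2
  have hvne : c ≠ v := (hD.region.adj hcv).ne
  -- The closed walk uses the chord exactly once: its other steps are boundary darts of `S`, while
  -- both darts of the chord lie in `S`.
  have hx1 : ¬ ((c, v) ∈ R ↔ (v, c) ∈ R) := by
    rw [← hRg _ _ (hD.region.adj hcv)]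
    rw [consecCount_eq_zero (i := v) (j := c)]
    · rw [List.cons_append, consecCount, ← List.cons_append, consecCount_eq_zero (fun h => hnc _ _ h hvc)]
      simp
    · rintro (⟨h, -⟩ | h)
      · exact hvne h.symm
      · exact hnc _ _ h hcv
  have hx2 : ∀ i j, (i, j) ∈ S → (j, i) ∈ S → ¬ ((i, j) ∈ R ↔ (j, i) ∈ R) →
      (i = c ∧ j = v) ∨ (i = v ∧ j = c) := by
    intro i j hij hji h
    rw [← hRg _ _ (hD.region.adj hij)] at h
    by_contra hn
    rw [not_or] at hn
    refine h ?_
    rw [consecCount_eq_zero, consecCount_eq_zero, add_zero]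
    · rintro (⟨rfl, rfl⟩ | h)
      · exact hn.2 ⟨rfl, rfl⟩
      · exact hnc _ _ h hij
    · rintro (⟨rfl, rfl⟩ | h)
      · exact hn.1 ⟨rfl, rfl⟩
      · exact hnc _ _ h hji
  -- `R` matters only up to complement; the side taken is the one that contains the triangle to the
  -- left of `cv`.
  obtain ⟨A, hA, hAS, hAcv, hAvc, hA2⟩ : ∃ A, 𝒯.IsRegion A ∧ A ⊆ S ∧ (c, v) ∈ A ∧ (v, c) ∉ A ∧
      ∀ i j, (i, j) ∈ A → (j, i) ∈ S → (j, i) ∉ A → i = c ∧ j = v := by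
    by_cases hc : (c, v) ∈ R
    · refine ⟨S ∩ R, hD.region.inter hR, Set.inter_subset_left, ⟨hcv, hc⟩,
        fun h => hx1 (iff_of_true hc h.2), fun i j h1 h2 h3 => ?_⟩
      rcases hx2 i j h1.1 h2 (fun h => h3 ⟨h2, h.1 h1.2⟩) with h | ⟨rfl, rfl⟩
      · exact h
      · exact (hx1 (iff_of_true hc h1.2)).elim
    · have hvR : (v, c) ∈ R := by tauto
      refine ⟨S \ R, hD.region.diff hR, Set.sdiff_subset, ⟨hcv, hc⟩,
        fun h => h.2 hvR, fun i j h1 h2 h3 => ?_⟩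
      rcases hx2 i j h1.1 h2 (fun h => h3 ⟨h2, fun h' => h1.2 (h.2 h')⟩) with h | ⟨rfl, rfl⟩
      · exact h
      · exact (h1.2 hvR).elim
  have hbA : ∀ i j, Bd A i j ↔ (i = c ∧ j = v) ∨ (Bd S i j ∧ (i, j) ∈ A) := by
    intro i j
    constructor
    · rintro ⟨h1, h2⟩
      by_cases h : (j, i) ∈ S
      · exact .inl (hA2 i j h1 h h2)
      · exact .inr ⟨⟨hAS h1, h⟩, h1⟩
    · rintro (⟨rfl, rfl⟩ | ⟨h1, h2⟩)
      · exact ⟨hAcv, hAvc⟩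
      · exact ⟨h2, fun h => h1.2 (hAS h)⟩
  have hin : ∀ {i i' j}, Bd S i j → Bd S i' j → i = i' := fun h h' =>
    Consec.left_unique hD.nodup ((hD.bd_iff _ _).1 h) ((hD.bd_iff _ _).1 h')
  have hout : ∀ {i j j'}, Bd S i j → Bd S i j' → j = j' := by
    intro i j j' h h'
    obtain ⟨a, ha⟩ := hD.region.exists_bd_in h
    exact hD.region.bd_out_unique (a := a) (fun b hb => hin hb ha) h h'
  -- the arc from `v` to `c` bounds `A`
  have harc1 : ∀ i j, Consec (v :: w :: l₀ ++ [c]) i j → (i, j) ∈ A := by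
    intro i j hij
    have hvw : Bd S v w := (hbd _ _).2 (.inr (.inr (.inl (.inl ⟨rfl, rfl⟩))))
    refine Consec.propagate (P := fun i j => (i, j) ∈ A) (l := l₀ ++ [c]) ?_ ?_ hij
    · obtain ⟨d, hd⟩ := hA.exists_bd_out ((hbA c v).2 (.inl ⟨rfl, rfl⟩))
      rcases (hbA _ _).1 hd with ⟨h, -⟩ | ⟨h1, h2⟩
      · exact (hvne h.symm).elim
      · rwa [hout hvw h1]
    · intro i j k h1 h2 h3
      have hij := (hbd i j).2 (.inr (.inr (.inl h1)))
      have hjk := (hbd j k).2 (.inr (.inr (.inl (.inr h2))))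
      obtain ⟨d, hd⟩ := hA.exists_bd_out ((hbA i j).2 (.inr ⟨hij, h3⟩))
      rcases (hbA _ _).1 hd with ⟨rfl, rfl⟩ | ⟨h1, h2⟩
      · have := h2.mem_dropLast
        rw [← List.cons_append, List.dropLast_concat] at this
        simp only [List.cons_append, List.nodup_cons, List.nodup_append, List.mem_cons] at hnd
        grind
      · rwa [hout hjk h1]
  -- the arc from `c` to `v` does not
  have harc2 : ∀ i j, Consec (c :: l₂ ++ [x, v]) i j → Bd S i j ∧ (i, j) ∉ A := by
    have hbd2 : ∀ i j, Consec (c :: l₂ ++ [x, v]) i j → Bd S i j := by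
      intro i j hij
      obtain ⟨m, hm⟩ : ∃ m, c :: l₂ = m ++ [y] := by
        exact List.getLast?_eq_some_iff.1 hlast
      rw [hm, List.append_assoc, List.singleton_append, consec_append_cons, ← hm] at hij
      rw [hbd]
      simp only [consec_cons_cons, consec_singleton, or_false] at hij
      tauto
    intro i j hij
    refine ⟨hbd2 i j hij, ?_⟩
    obtain ⟨d, t, hdt⟩ : ∃ d t, l₂ ++ [x, v] = d :: t := by
      cases l₂ <;> simp
    rw [List.cons_append, hdt] at hij hbd2
    refine Consec.propagate (P := fun i j => (i, j) ∉ A) ?_ ?_ hij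
    · intro h
      have hcd : Bd S c d := hbd2 c d (.inl ⟨rfl, rfl⟩)
      have hd := (hbA c d).2 (.inr ⟨hcd, h⟩)
      have hv := (hbA c v).2 (.inl ⟨rfl, rfl⟩)
      obtain ⟨a, ha⟩ := hD.region.exists_bd_in hcd
      -- If `A` contained `cd`, it would have the outgoing boundary darts `cd` and `cv` at `c`, but
      -- at most one incoming.
      have : d = v := by
        refine hA.bd_out_unique (a := a) (fun b hb => ?_) hd hv
        rcases (hbA b c).1 hb with ⟨-, h⟩ | ⟨h, -⟩
        · exact (hvne h).elim
        · exact hin h ha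
      exact hcd.2 (this ▸ hvc)
    · intro i j k h1 h2 h3 h4
      have hij := hbd2 i j h1
      have hjk := hbd2 j k (.inr h2)
      obtain ⟨a, ha⟩ := hA.exists_bd_in ((hbA j k).2 (.inr ⟨hjk, h4⟩))
      rcases (hbA _ _).1 ha with ⟨rfl, rfl⟩ | ⟨h5, h6⟩
      · have := h2.mem_dropLast
        rw [← hdt, show l₂ ++ [x, j] = (l₂ ++ [x]) ++ [j] by simp, List.dropLast_concat] at this
        simp only [List.cons_append, List.nodup_cons, List.nodup_append, List.mem_cons] at hnd
        grind
      · exact h3 (hin hij h5 ▸ h6)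
  have harc2' : ∀ i j, (i = y ∧ j = x) ∨ (i = x ∧ j = v) ∨ Consec (c :: l₂) i j → (i, j) ∉ A := by
    obtain ⟨m, hm⟩ : ∃ m, c :: l₂ = m ++ [y] := by
      exact List.getLast?_eq_some_iff.1 hlast
    intro i j h
    refine (harc2 i j ?_).2
    rw [hm, List.append_assoc, List.singleton_append, consec_append_cons, ← hm]
    simp only [consec_cons_cons, consec_singleton, or_false]
    tauto
  refine ⟨A, ⟨hAS, fun h => hAvc (h hvc)⟩, ⟨Set.sdiff_subset, fun h => (h hcv).2 hAcv⟩,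
    ⟨hA, ?_, getLast?_append_cons _ _ _, ?_⟩, ⟨hD.region.diff hA, ?_, ?_, ?_⟩⟩
  · exact hnd.sublist ((List.sublist_cons_self x _).append (by simp))
  · intro i j
    rw [hbA, List.cons_append, consec_cons_cons, ← List.cons_append, hbd]
    have h1 := harc1 i j
    have h2 := harc2' i j
    constructor
    · rintro (h | ⟨h | h | h | h, h'⟩)
      · exact .inl h
      · exact (h2 (.inl h) h').elim
      · exact (h2 (.inr (.inl h)) h').elim
      · exact .inr h
      · exact (h2 (.inr (.inr h)) h').elim
    · rintro (h | h)
      · exact .inl h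
      · exact .inr ⟨.inr (.inr (.inl h)), h1 h⟩
  · exact hnd.sublist (List.Sublist.append (l₁ := [x, v]) (by simp) (List.Sublist.refl _))
  · exact (getLast?_append_cons [x, v] c l₂).trans hlast
  · intro i j
    have key : Bd (S \ A) i j ↔ (i = v ∧ j = c) ∨ (Bd S i j ∧ (i, j) ∉ A) := by
      constructor
      · rintro ⟨⟨h1, h2⟩, h3⟩
        by_cases h : (j, i) ∈ S
        · have h4 : (j, i) ∈ A := by
            by_contra h4; exact h3 ⟨h, h4⟩
          exact .inl (hA2 j i h4 h1 h2).symm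
        · exact .inr ⟨⟨h1, h⟩, h2⟩
      · rintro (⟨rfl, rfl⟩ | ⟨h1, h2⟩)
        · exact ⟨⟨hvc, hAvc⟩, fun h => h.2 hAcv⟩
        · exact ⟨⟨h1.1, h2⟩, fun h => h1.2 h.1⟩
    rw [key, hbd]
    simp only [consec_cons_cons]
    have h1 := harc1 i j
    have h2 := harc2' i j
    constructor
    · rintro (h | ⟨h | h | h | h, h'⟩)
      · exact .inr (.inr (.inl h))
      · exact .inl h
      · exact .inr (.inl h)
      · exact (h' (h1 h)).elim
      · exact .inr (.inr (.inr h))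
    · rintro (h | h | h | h)
      · exact .inr ⟨.inl h, h2 (.inl h)⟩
      · exact .inr ⟨.inr (.inl h), h2 (.inr (.inl h))⟩
      · exact .inl h
      · exact .inr ⟨.inr (.inr (.inr h)), h2 (.inr (.inr h))⟩

end IsDisk

end SphereTriangulation

/-! ### The induction over disks. -/

namespace SphereTriangulation

variable {V F : Type*} [Fintype V] [Field F] {G : SimpleGraph V} {𝒯 : SphereTriangulation G}

theorem IsRegion.not_mem_edges_of_coeff {lin : Sym2 V → MvPolynomial V F}
    (hlin : IsEdgeForm G lin) {S : Set (V × V)} (hS : 𝒯.IsRegion S) {E : Finset (Sym2 V)}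
    (hE : E ⊆ edges S) {M : V →₀ ℕ} (hM : coeff M (∏ e ∈ E, lin e) ≠ 0) {z : V}
    (hz : z ∉ {z | ∃ e ∈ edges S, z ∈ e}) : M z = 0 :=
  eq_zero_of_coeff_prod_edgeForm_ne_zero hlin (fun _ he => hS.edges_subset (hE he))
    (fun e he hze => hz ⟨e, hE he, hze⟩) hM

namespace IsDisk

variable {S : Set (V × V)} {y : V}

open Classical in
/-- The monomials of two disks sharing a chord combine. -/
theorem exists_monomial_of_chord {lin : Sym2 V → MvPolynomial V F} (hlin : IsEdgeForm G lin)
    {A : Set (V × V)} {x v c : V} {p₁ q : List V} (hAS : A ⊆ S)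
    (hA : 𝒯.IsDisk A c p₁) (hB : 𝒯.IsDisk (S \ A) y (x :: q))
    (hp : ∀ z ∈ p₁, z ∈ x :: q → z = v ∨ z = c) (hvc : s(v, c) ∈ edges (S \ A))
    (hvc' : s(v, c) ≠ s(x, y))
    {N₁ N₂ : V →₀ ℕ} (h₁ : coeff N₁ (∏ e ∈ (edges A).erase s(v, c), lin e) ≠ 0)
    (hv : N₁ v = 0) (hc : N₁ c = 0) (h₁2 : ∀ z ∈ p₁, N₁ z ≤ 2) (h₁4 : ∀ z, N₁ z ≤ 4)
    (h₂ : coeff N₂ (∏ e ∈ (edges (S \ A)).erase s(x, y), lin e) ≠ 0)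
    (hx : N₂ x = 0) (hy : N₂ y = 0) (h₂2 : ∀ z ∈ x :: q, N₂ z ≤ 2) (h₂4 : ∀ z, N₂ z ≤ 4) :
    ∃ N : V →₀ ℕ, coeff N (∏ e ∈ (edges S).erase s(x, y), lin e) ≠ 0 ∧ N x = 0 ∧ N y = 0 ∧
      (∀ z, z ∈ p₁ ∨ z ∈ x :: q → N z ≤ 2) ∧ ∀ z, N z ≤ 4 := by
  have hdisj : Disjoint A (S \ A) := Set.disjoint_sdiff_right
  have hcommon : ∀ z, z ∈ {z | ∃ e ∈ edges (S \ A), z ∈ e} → z ∈ {z | ∃ e ∈ edges A, z ∈ e} →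
      z = v ∨ z = c := by
    rintro z ⟨e₂, he₂, hz₂⟩ ⟨e₁, he₁, hz₁⟩
    exact hp z (hA.mem_of_mem_edges hB.region hdisj he₁ hz₁ he₂ hz₂)
      (hB.mem_of_mem_edges hA.region hdisj.symm he₂ hz₂ he₁ hz₁)
  have hcommon' : ∀ e ∈ edges A, e ∈ edges (S \ A) → e = s(v, c) := by
    intro e h1 h2
    have hne := hA.region.edges_subset h1
    induction e with | _ i j
    have hi := hcommon i ⟨_, h2, by simp⟩ ⟨_, h1, by simp⟩
    have hj := hcommon j ⟨_, h2, by simp⟩ ⟨_, h1, by simp⟩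
    have hne : i ≠ j := SimpleGraph.Adj.ne hne
    rw [Sym2.eq_iff]
    rcases hi with rfl | rfl <;> rcases hj with rfl | rfl <;> simp_all
  have hyx : Bd (S \ A) y x := by
    rw [hB.bd_iff]
    exact .inl ⟨rfl, rfl⟩
  have hxyA : s(x, y) ∉ edges A := fun h =>
    hvc' (hcommon' _ h (mk_mem_edges.2 (.inr hyx.1))).symm
  -- The chord belongs to both parts; it is counted in `S \ A` and erased from `A`, where it plays
  -- the role of the special edge.
  have hE : (edges S).erase s(x, y) =
      (edges (S \ A)).erase s(x, y) ∪ (edges A).erase s(v, c) := by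
    ext e
    induction e with | _ i j
    simp only [Finset.mem_union, Finset.mem_erase]
    constructor
    · rintro ⟨h1, h2⟩
      by_cases hB : s(i, j) ∈ edges (S \ A)
      · exact .inl ⟨h1, hB⟩
      · refine .inr ⟨fun h => hB (h ▸ hvc), ?_⟩
        rw [mk_mem_edges] at h2 hB ⊢
        simp only [Set.mem_sdiff] at hB
        tauto
    · rintro (⟨h1, h2⟩ | ⟨h1, h2⟩)
      · exact ⟨h1, edges_mono Set.sdiff_subset h2⟩
      · exact ⟨fun h => hxyA (h ▸ h2), edges_mono hAS h2⟩
  have hd : Disjoint ((edges (S \ A)).erase s(x, y)) ((edges A).erase s(v, c)) := by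
    rw [Finset.disjoint_left]
    intro e h1 h2
    exact (Finset.mem_erase.1 h2).1
      (hcommon' e (Finset.mem_of_mem_erase h2) (Finset.mem_of_mem_erase h1))
  have hzero₂ := fun z => hB.region.not_mem_edges_of_coeff hlin (Finset.erase_subset _ _) h₂ (z := z)
  have hzero₁ := fun z => hA.region.not_mem_edges_of_coeff hlin (Finset.erase_subset _ _) h₁ (z := z)
  -- The two parts share only `v` and `c`, where `N₁` vanishes. So the supports of `N₁` and `N₂` are
  -- disjoint and all degree bounds carry over to the sum.
  have hzero : ∀ z, z ∈ {z | ∃ e ∈ edges (S \ A), z ∈ e} → N₁ z = 0 := by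
    intro z hz
    by_cases hz' : z ∈ {z | ∃ e ∈ edges A, z ∈ e}
    · rcases hcommon z hz hz' with rfl | rfl <;> assumption
    · exact hzero₁ z hz'
  refine ⟨N₂ + N₁, ?_, ?_, ?_, ?_, ?_⟩
  · rw [hE, Finset.prod_union hd, coeff_add_mul_of_disjoint
      (isHomogeneous_prod_edgeForm hlin fun e he =>
        hA.region.edges_subset (Finset.mem_of_mem_erase he))
      (fun M hM z hz => hB.region.not_mem_edges_of_coeff hlin (Finset.erase_subset _ _) hM hz)
      (fun M hM z hz => hA.region.not_mem_edges_of_coeff hlin (Finset.erase_subset _ _) hM hz)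
      h₂ h₁ (fun z hz _ => hzero z hz)]
    exact mul_ne_zero h₂ h₁
  · simp [hx, hzero x (hB.exists_mem_edges (by simp))]
  · simp [hy, hzero y (hB.exists_mem_edges (hB.mem_of_bd_left hyx))]
  · intro z hz
    by_cases hz' : z ∈ {z | ∃ e ∈ edges (S \ A), z ∈ e}
    · have h0 := hzero z hz'
      rw [Finsupp.add_apply, h0, add_zero]
      rcases hz with hz | hz
      · refine h₂2 z ?_
        obtain ⟨e₁, he₁, hz₁⟩ := hA.exists_mem_edges hz
        obtain ⟨e₂, he₂, hz₂⟩ := hz'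
        exact hB.mem_of_mem_edges hA.region hdisj.symm he₂ hz₂ he₁ hz₁
      · exact h₂2 z hz
    · rw [Finsupp.add_apply, hzero₂ z hz', zero_add]
      rcases hz with hz | hz
      · exact h₁2 z hz
      · exact (hz' (hB.exists_mem_edges hz)).elim
  · intro z
    by_cases hz' : z ∈ {z | ∃ e ∈ edges (S \ A), z ∈ e}
    · rw [Finsupp.add_apply, hzero z hz', add_zero]
      exact h₂4 z
    · rw [Finsupp.add_apply, hzero₂ z hz', zero_add]
      exact h₁4 z

/-- A disk bounded by the triangle `xvw` whose edge `xv` lies in the triangle `xvw` is just this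
triangle. -/
theorem eq_triDarts {x v : V} (hD : 𝒯.IsDisk S y [x, v, y]) (ht : 𝒯.Tri x v y) :
    S = triDarts x v y := by
  have hbd : ∀ i j, Bd S i j ↔ (i, j) ∈ triDarts x v y := by
    intro i j
    rw [hD.bd_iff, mem_triDarts]
    simp only [consec_cons_cons, consec_singleton]
    tauto
  have hxv : Bd S x v := (hbd _ _).2 (by simp [mem_triDarts])
  have hsub := mem_of_tri hD.region ht hxv.1
  refine Set.Subset.antisymm ?_ hsub
  -- What remains of `S` has no boundary, so it is empty or the whole sphere; the latter would
  -- contain the dart `vx`, which is not in `S`.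
  have hR := hD.region.diff (isRegion_triDarts ht)
  have hnb : ∀ i j, ¬ Bd (S \ triDarts x v y) i j := by
    rintro i j ⟨⟨h1, h2⟩, h3⟩
    by_cases h : (j, i) ∈ S
    · have : (j, i) ∈ triDarts x v y := by
        by_contra h4; exact h3 ⟨h, h4⟩
      exact ((hbd _ _).2 this).2 h1
    · exact h2 ((hbd _ _).1 ⟨h1, h⟩)
  rintro ⟨i, j⟩ hij
  by_contra hn
  exact hxv.2 (hR.eq_univ_of_not_bd hnb ⟨hij, hn⟩ (hD.region.adj hxv.1).symm).1

open Classical in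
-- The bound 2 on the boundary is what makes the induction close: after a boundary vertex is
-- deleted, its inner neighbours lie on the boundary, and the slack up to 4 pays for the restored
-- edges and for the possible exchange with `w`. The induction is on the number of darts of `S`.
theorem exists_monomial {lin : Sym2 V → MvPolynomial V F} (hlin : IsEdgeForm G lin) {x : V}
    {q : List V} (hD : 𝒯.IsDisk S y (x :: q)) :
    ∃ N : V →₀ ℕ, coeff N (∏ e ∈ (edges S).erase s(x, y), lin e) ≠ 0 ∧ N x = 0 ∧ N y = 0 ∧
      (∀ z ∈ x :: q, N z ≤ 2) ∧ ∀ z, N z ≤ 4 := by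
  induction hn : S.ncard using Nat.strong_induction_on generalizing S x y q with
  | _ n ih =>
  subst hn
  have hyx : Bd S y x := (hD.bd_iff _ _).2 (.inl ⟨rfl, rfl⟩)
  obtain _ | ⟨v, _ | ⟨w, l⟩⟩ := q
  · have : x = y := by simpa using hD.last
    exact ((hD.region.adj hyx.1).ne this.symm).elim
  · have : v = y := by simpa using hD.last
    subst this
    exact (hyx.2 ((hD.bd_iff _ _).2 (.inr (.inl ⟨rfl, rfl⟩))).1).elim
  have hxv : Bd S x v := (hD.bd_iff _ _).2 (.inr (.inl ⟨rfl, rfl⟩))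
  have hvw : Bd S v w := (hD.bd_iff _ _).2 (.inr (.inr (.inl ⟨rfl, rfl⟩)))
  have hnd := hD.nodup
  by_cases hch : ∃ c ∈ x :: v :: w :: l, (v, c) ∈ S ∧ (c, v) ∈ S
  · obtain ⟨c, hc, hvc, hcv⟩ := hch
    have hcl : c ∈ l := by
      simp only [List.mem_cons] at hc
      rcases hc with rfl | rfl | rfl | hc
      · exact (hxv.2 hvc).elim
      · exact ((hD.region.adj hvc).ne rfl).elim
      · exact (hvw.2 hcv).elim
      · exact hc
    obtain ⟨l₀, l₂, rfl⟩ := List.append_of_mem hcl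
    obtain ⟨A, hA1, hA2, hA, hB⟩ := split_chord (l₀ := l₀) (l₂ := l₂) hD hvc hcv
    obtain ⟨N₁, a1, a2, a3, a4, a5⟩ :=
      ih _ (Set.ncard_lt_ncard hA1 (Set.toFinite _)) (q := w :: l₀ ++ [c]) hA rfl
    obtain ⟨N₂, b1, b2, b3, b4, b5⟩ := ih _ (Set.ncard_lt_ncard hA2 (Set.toFinite _)) hB rfl
    have hBvc : Bd (S \ A) v c := (hB.bd_iff _ _).2 (.inr (.inr (.inl ⟨rfl, rfl⟩)))
    have hlast := hD.last
    obtain ⟨N, c1, c2, c3, c4, c5⟩ := exists_monomial_of_chord hlin hA1.1 hA hB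
      (v := v) (c := c) (by
        intro z h1 h2
        simp only [List.cons_append, List.nodup_cons, List.nodup_append, List.mem_cons,
          List.mem_append] at hnd h1 h2
        grind)
      (mk_mem_edges.2 (.inl hBvc.1))
      (by
        have : v ≠ x := (hD.region.adj hxv.1).ne.symm
        have : v ≠ y := by
          rintro rfl
          exact hD.region.bd_out_unique (z := v) (a := x) (fun b hb =>
            Consec.left_unique hD.nodup ((hD.bd_iff _ _).1 hb) ((hD.bd_iff _ _).1 hxv))
            hyx hvw ▸ List.nodup_cons.1 hnd |>.1 <| by simp
        rw [Ne, Sym2.eq_iff]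
        tauto)
      a1 a2 a3 a4 a5 b1 b2 b3 b4 b5
    refine ⟨N, c1, c2, c3, fun z hz => c4 z ?_, c5⟩
    simp only [List.cons_append, List.mem_cons, List.mem_append] at hz ⊢
    tauto
  have hch' : ∀ c ∈ x :: v :: w :: l, (v, c) ∈ S → (c, v) ∉ S := fun c h1 h2 h3 =>
    hch ⟨c, h1, h2, h3⟩
  have hvx : v ≠ x := (hD.region.adj hxv.1).ne.symm
  have hvw' : v ≠ w := (hD.region.adj hvw.1).ne
  have hvy : v ≠ y := by
    have := hD.last
    rintro rfl
    have h1 : v ∈ w :: l := List.mem_of_getLast? (by simpa using this)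
    simp only [List.nodup_cons] at hnd
    exact hnd.2.1 h1
  have hxw : x ≠ w := by
    rintro rfl
    simp at hnd
  have hyp : y ∈ x :: v :: w :: l := hD.mem_of_bd_left hyx
  -- A smaller disk and the empty remainder of a single triangle are put into one form. Edges are
  -- compared only away from `xy`, since in the second case `xy` is lost together with the triangle.
  obtain ⟨us, S', hS', i3, i4, i5, i6, N', n1, n2, n3, n4, n5⟩ :
      ∃ (us : List V) (S' : Set (V × V)), S' ⊆ S ∧ v ∉ us ∧
      (∀ u ∈ us, u ∉ x :: v :: w :: l) ∧
      (∀ e, e ≠ s(x, y) → (e ∈ edges S ↔ e ∈ edges S' ∨ ∃ z ∈ x :: w :: us, e = s(v, z))) ∧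
      (∀ z, s(v, z) ∉ edges S') ∧
      ∃ N : V →₀ ℕ, coeff N (∏ e ∈ (edges S').erase s(x, y), lin e) ≠ 0 ∧ N x = 0 ∧ N y = 0 ∧
        (∀ z ∈ x :: (us ++ w :: l), N z ≤ 2) ∧ ∀ z, N z ≤ 4 := by
    by_cases hdeg : 𝒯.Tri x v w → (x, w) ∈ S
    · obtain ⟨us, S', i1, i2, i3, i4, i5, i6⟩ := remove_vertex (pre := []) hD hch' hdeg
      exact ⟨us, S', i1.1, i3, i4, fun e _ => i5 e, i6,
        ih _ (Set.ncard_lt_ncard i1 (Set.toFinite _)) i2 rfl⟩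
    -- Here `wx` is itself a boundary dart, so `w = y` and `S` is the single triangle `x v y`.
    -- Nothing is left after deleting `v`: the product is 1 and its monomial is `0`.
    · simp only [Classical.not_imp] at hdeg
      obtain ⟨ht, hxwS⟩ := hdeg
      have hwx : Bd S w x := ⟨mem_of_tri hD.region ht hxv.1 (by simp [mem_triDarts]), hxwS⟩
      have hwy : w = y :=
        Consec.left_unique hD.nodup ((hD.bd_iff _ _).1 hwx) ((hD.bd_iff _ _).1 hyx)
      subst hwy
      have hl : l = [] := by
        have h1 := hD.last
        rw [List.getLast?_cons_cons, List.getLast?_cons_cons] at h1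
        cases l with
        | nil => rfl
        | cons a l =>
          rw [List.getLast?_cons_cons] at h1
          have := List.mem_of_getLast? h1
          simp only [List.nodup_cons] at hnd
          exact (hnd.2.2.1 this).elim
      subst hl
      have hS := hD.eq_triDarts ht
      refine ⟨[], ∅, by simp, by simp, by simp, ?_, by simp [edges_eq_empty], 0,
        by simp [edges_eq_empty], by simp, by simp, by simp, by simp⟩
      intro e he
      rw [mem_edges]
      simp only [hS, edges_eq_empty, mem_triDarts]
      constructor
      · rintro ⟨i, j, ⟨rfl, rfl⟩ | ⟨rfl, rfl⟩ | ⟨rfl, rfl⟩, rfl⟩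
        · simp
        · simp
        · exact (he Sym2.eq_swap).elim
      · rintro (h | ⟨z, hz, rfl⟩)
        · simp at h
        · simp only [List.mem_cons, List.not_mem_nil, or_false] at hz
          rcases hz with rfl | rfl
          · exact ⟨z, v, by simp, Sym2.eq_swap⟩
          · exact ⟨v, z, by simp, rfl⟩
  have hxyv : ∀ z, s(v, z) ≠ s(x, y) := by
    intro z h
    rcases Sym2.eq_iff.1 h with ⟨h, -⟩ | ⟨h, -⟩
    exacts [hvx h, hvy h]
  have hadj : ∀ z ∈ x :: w :: us, G.Adj v z := by
    intro z hz
    exact hD.region.edges_subset ((i5 _ (hxyv z)).2 (.inr ⟨z, hz, rfl⟩))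
  have hform : ∀ z, G.Adj v z → ∃ a b : F, a ≠ 0 ∧ b ≠ 0 ∧
      lin s(v, z) = C a * X v + C b * X z := hlin v
  choose! a b ha hb hab using hform
  have hxus : x ∉ us := fun h => i4 x h (by simp)
  have hwus : w ∉ us := fun h => i4 w h (by simp)
  have hprod : ∏ e ∈ (edges S).erase s(x, y), lin e =
      (C (a x) * X v + C (b x) * X x) * ((C (a w) * X v + C (b w) * X w) *
        ((∏ u ∈ us.toFinset, (C (a u) * X v + C (b u) * X u)) *
          ∏ e ∈ (edges S').erase s(x, y), lin e)) := by
    have hE : (edges S).erase s(x, y) =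
        (insert x (insert w us.toFinset)).image (fun z => s(v, z)) ∪
          (edges S').erase s(x, y) := by
      ext e
      simp only [Finset.mem_union, Finset.mem_erase, Finset.mem_image, Finset.mem_insert,
        List.mem_toFinset]
      constructor
      · rintro ⟨h1, h2⟩
        rcases (i5 e h1).1 h2 with h | ⟨z, hz, rfl⟩
        · exact .inr ⟨h1, h⟩
        · exact .inl ⟨z, by simpa using hz, rfl⟩
      · rintro (⟨z, hz, rfl⟩ | ⟨h1, h2⟩)
        · exact ⟨hxyv z, (i5 _ (hxyv z)).2 (.inr ⟨z, by simpa using hz, rfl⟩)⟩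
        · exact ⟨h1, (i5 e h1).2 (.inl h2)⟩
    rw [hE, Finset.prod_union, Finset.prod_image (fun i _ j _ h => Sym2.congr_right.1 h),
      Finset.prod_insert (by simp [hxw, hxus]), Finset.prod_insert (by simp [hwus]),
      hab x (hadj x (by simp)), hab w (hadj w (by simp)), Finset.prod_congr rfl fun u hu =>
        hab u (hadj u (by simp [List.mem_toFinset.1 hu])), mul_assoc, mul_assoc]
    rw [Finset.disjoint_left]
    intro e he he'
    obtain ⟨z, -, rfl⟩ := Finset.mem_image.1 he
    exact i6 z (Finset.mem_of_mem_erase he')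
  have hv0 : ∀ M, coeff M (∏ e ∈ (edges S').erase s(x, y), lin e) ≠ 0 → M v = 0 := by
    intro M hM
    refine eq_zero_of_coeff_prod_edgeForm_ne_zero hlin (fun e he =>
      hD.region.edges_subset (edges_mono hS' (Finset.mem_of_mem_erase he))) ?_ hM
    intro e he hve
    obtain ⟨z, rfl⟩ := Sym2.mem_iff_exists.1 hve
    exact i6 z (Finset.mem_of_mem_erase he)
  rw [hprod]
  obtain ⟨N, m1, m2, m3, m4, m5, m6⟩ := exists_monomial_restore_vertex (v := v) (x := x) (w := w)
    (y := y) (U := us.toFinset) (B := {z | z ∈ x :: v :: w :: l}) (a := a) (b := b)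
    (by rintro z (rfl | rfl) <;> exact ha _ (hadj _ (by simp)))
    (by
      rintro z (rfl | hz)
      · exact hb _ (hadj _ (by simp))
      · exact hb _ (hadj _ (by simp [List.mem_toFinset.1 hz])))
    hv0 (by simpa using i3) hvx hvw' hvy hxw (fun u hu => i4 u (List.mem_toFinset.1 hu))
    (by simp) (by simp) hyp n1 n2 n3
    (by
      intro z hz
      by_cases hzv : z = v
      · simp [hzv, hv0 _ n1]
      · refine n4 z ?_
        simp only [Set.mem_ofPred_eq, List.mem_cons, List.mem_toFinset, List.mem_append] at hz ⊢
        tauto) n5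
  refine ⟨N, m1, m2, m3, fun z hz => ?_, m6⟩
  by_cases hzv : z = v
  · exact hzv ▸ m4
  · exact m5 z hz hzv

end IsDisk

end SphereTriangulation

/-! ### From Euler's formula to the vanishing of mod 2 homology. -/

namespace RotationSystem

variable {V : Type*} {G : SimpleGraph V} (R : RotationSystem G)

/-- The face to the left of a dart. -/
def face (d : G.Dart) : R.Face := Quotient.mk (Equiv.Perm.SameCycle.setoid R.facePerm) d

theorem facePerm_apply (d : G.Dart) : R.facePerm d = R.next d.symm := rfl

theorem fst_facePerm (d : G.Dart) : (R.facePerm d).fst = d.snd := R.fst_next d.symm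

theorem face_facePerm (d : G.Dart) : R.face (R.facePerm d) = R.face d :=
  Quotient.sound (Equiv.Perm.sameCycle_apply_left.2 (Equiv.Perm.SameCycle.refl _ _))

theorem face_next (d : G.Dart) : R.face (R.next d) = R.face d.symm := by
  rw [← R.face_facePerm d.symm, R.facePerm_apply, SimpleGraph.Dart.symm_symm]

theorem facePerm_eq {d : G.Dart} {b c : V} (h : G.Adj b c) (hb : d.snd = b)
    (hc : (R.facePerm d).snd = c) : R.facePerm d = ⟨(b, c), h⟩ := by
  apply SimpleGraph.Dart.ext
  exact Prod.ext ((R.fst_facePerm d).trans hb) hc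

/-- A property of the darts at a vertex that is preserved by the rotation is shared by all. -/
theorem of_next [Finite V] {P : G.Dart → Prop} (h : ∀ d, P d → P (R.next d)) {d d' : G.Dart}
    (hd : P d) (hdd : d.fst = d'.fst) : P d' := by
  have : Finite G.Dart := Finite.of_injective _ SimpleGraph.Dart.toProd_injective
  obtain ⟨n, -, -, rfl⟩ := (R.sameCycle_of_fst_eq d d' hdd).exists_pow_eq'
  clear hdd
  induction n with
  | zero => exact hd
  | succ n ih =>
    rw [pow_succ', Equiv.Perm.mul_apply]
    exact h _ ih

theorem _root_.SimpleGraph.Connected.eq_of_forall_adj {α : Type*} (hG : G.Connected) {φ : V → α}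
    (h : ∀ a b, G.Adj a b → φ a = φ b) (a b : V) : φ a = φ b := by
  obtain ⟨w⟩ := hG.preconnected a b
  induction w with
  | nil => rfl
  | cons hadj _ ih => exact (h _ _ hadj).trans ih

section Homology

open Classical Module

variable [Fintype V]

/-- The boundary modulo two of a set of faces. -/
noncomputable def faceBoundary : (R.Face → ZMod 2) →ₗ[ZMod 2] (G.edgeSet → ZMod 2) where
  toFun f e := ∑ d : G.Dart, if d.edge = e.1 then f (R.face d) else 0
  map_add' f g := by
    ext e
    simp only [Pi.add_apply, ← Finset.sum_add_distrib]
    exact Finset.sum_congr rfl fun d _ => by split_ifs <;> simp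
  map_smul' c f := by
    ext e
    simp only [Pi.smul_apply, smul_eq_mul, Finset.mul_sum, RingHom.id_apply]
    exact Finset.sum_congr rfl fun d _ => by split_ifs <;> simp

/-- The vertex-edge incidence matrix modulo two. -/
noncomputable def incidence (G : SimpleGraph V) : Matrix V G.edgeSet (ZMod 2) :=
  Matrix.of fun v e => if v ∈ e.1 then 1 else 0

theorem faceBoundary_apply (f : R.Face → ZMod 2) (d : G.Dart) :
    R.faceBoundary f ⟨d.edge, d.edge_mem⟩ = f (R.face d) + f (R.face d.symm) := by
  change ∑ d' : G.Dart, (if d'.edge = d.edge then f (R.face d') else 0) = _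
  have : ∀ d' : G.Dart, (if d'.edge = d.edge then f (R.face d') else 0) =
      (if d' = d then f (R.face d') else 0) + (if d' = d.symm then f (R.face d') else 0) := by
    intro d'
    simp only [SimpleGraph.dart_edge_eq_iff]
    by_cases h1 : d' = d
    · subst h1
      simp [d'.symm_ne.symm]
    · simp [h1]
  rw [Finset.sum_congr rfl fun d' _ => this d', Finset.sum_add_distrib]
  simp

theorem incidence_transpose_mulVec (φ : V → ZMod 2) {a b : V} (h : G.Adj a b) :
    ((incidence G).transpose.mulVec φ) ⟨s(a, b), h⟩ = φ a + φ b := by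
  have : ∀ v, (if v ∈ s(a, b) then (1 : ZMod 2) else 0) * φ v =
      (if v = a then φ v else 0) + (if v = b then φ v else 0) := by
    intro v
    have := h.ne
    simp only [Sym2.mem_iff]
    by_cases h1 : v = a
    · subst h1; simp [this]
    · simp [h1]
  simp only [Matrix.mulVec, dotProduct, incidence, Matrix.transpose_apply, Matrix.of_apply]
  rw [Finset.sum_congr rfl fun v _ => this v, Finset.sum_add_distrib]
  simp

/-- At a vertex, the face to the right of a dart is the face to the left of the next dart in the
rotation. Summed around the vertex, left and right faces therefore agree and cancel modulo two. -/
theorem incidence_mulVec_faceBoundary (f : R.Face → ZMod 2) :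
    (incidence G).mulVec (R.faceBoundary f) = 0 := by
  ext v
  have h1 : (incidence G).mulVec (R.faceBoundary f) v =
      ∑ d : G.Dart, if v ∈ d.edge then f (R.face d) else 0 := by
    simp only [Matrix.mulVec, dotProduct, incidence, Matrix.of_apply, faceBoundary,
      LinearMap.coe_mk, AddHom.coe_mk, Finset.mul_sum]
    rw [Finset.sum_comm]
    refine Finset.sum_congr rfl fun d _ => ?_
    rw [Finset.sum_eq_single ⟨d.edge, d.edge_mem⟩]
    · simp
    · intro e _ he
      rw [if_neg (c := d.edge = e.1) fun h => he (Subtype.ext h.symm), mul_zero]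
    · simp
  have h2 : ∀ d : G.Dart, (if v ∈ d.edge then f (R.face d) else 0) =
      (if d.fst = v then f (R.face d) else 0) + (if d.snd = v then f (R.face d) else 0) := by
    intro d
    have hne := d.fst_ne_snd
    simp only [show d.edge = s(d.fst, d.snd) from rfl, Sym2.mem_iff]
    by_cases h : d.fst = v
    · subst h; simp [hne.symm]
    · have h' : v ≠ d.fst := fun e => h e.symm
      simp [h, h', eq_comm]
  have h3 : ∑ d : G.Dart, (if d.snd = v then f (R.face d) else 0) =
      ∑ d : G.Dart, if d.fst = v then f (R.face d.symm) else 0 :=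
    (Equiv.sum_comp (Function.Involutive.toPerm SimpleGraph.Dart.symm
      SimpleGraph.Dart.symm_involutive)
      (fun d : G.Dart => if d.snd = v then f (R.face d) else 0)).symm
  have h4 : ∑ d : G.Dart, (if d.fst = v then f (R.face d) else 0) =
      ∑ d : G.Dart, if d.fst = v then f (R.face d.symm) else 0 := by
    rw [← Equiv.sum_comp R.next]
    simp only [R.fst_next, R.face_next]
  rw [h1, Finset.sum_congr rfl fun d _ => h2 d, Finset.sum_add_distrib, h3, h4]
  exact CharTwo.add_self_eq_zero _

theorem finrank_le_one_of_const {ι : Type*} [Finite ι] (W : Submodule (ZMod 2) (ι → ZMod 2))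
    (h : ∀ f ∈ W, ∀ i j, f i = f j) : finrank (ZMod 2) W ≤ 1 := by
  have hW : W ≤ Submodule.span (ZMod 2) {1} := by
    intro f hf
    rw [Submodule.mem_span_singleton]
    rcases isEmpty_or_nonempty ι with hι | ⟨⟨i⟩⟩
    · exact ⟨0, Subsingleton.elim _ _⟩
    · exact ⟨f i, by ext j; simp [h f hf i j]⟩
  calc finrank (ZMod 2) W ≤ _ := Submodule.finrank_mono hW
    _ ≤ _ := finrank_span_le_card _
    _ = 1 := by simp

/-- On the sphere every cycle modulo two is a boundary. -/
theorem range_faceBoundary (hR : R.IsPlane) :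
    LinearMap.range R.faceBoundary = LinearMap.ker (incidence G).mulVecLin := by
  obtain ⟨hconn, heuler⟩ := hR
  have : Finite R.Face := by unfold Face; infer_instance
  have : Fintype R.Face := Fintype.ofFinite _
  refine Submodule.eq_of_le_of_finrank_le ?_ ?_
  · rintro _ ⟨f, rfl⟩
    exact R.incidence_mulVec_faceBoundary f
  -- A function in the kernel takes equal values on both sides of each edge, hence is constant
  -- around each vertex, hence constant by connectedness.
  have hk2 : finrank (ZMod 2) (LinearMap.ker R.faceBoundary) ≤ 1 := by
    refine finrank_le_one_of_const _ fun f hf => ?_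
    have hsymm : ∀ d : G.Dart, f (R.face d) = f (R.face d.symm) := by
      intro d
      have := R.faceBoundary_apply f d
      rw [LinearMap.mem_ker.1 hf] at this
      exact CharTwo.add_eq_zero.1 this.symm
    have hloc : ∀ d d' : G.Dart, d.fst = d'.fst → f (R.face d) = f (R.face d') := by
      intro d d' h
      refine R.of_next (P := fun e => f (R.face d) = f (R.face e)) (fun e he => ?_) rfl h
      rw [he, R.face_next, hsymm e]
    have key : ∀ a b, ∀ d d' : G.Dart, d.fst = a → d'.fst = b →
        f (R.face d) = f (R.face d') := by
      intro a b
      obtain ⟨w⟩ := hconn.preconnected a b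
      induction w with
      | nil => exact fun d d' h h' => hloc d d' (h.trans h'.symm)
      | cons hadj _ ih =>
        intro d d' h h'
        rw [hloc d ⟨(_, _), hadj⟩ h, hsymm]
        exact ih _ d' rfl h'
    intro i j
    obtain ⟨d, rfl⟩ := Quotient.exists_rep i
    obtain ⟨d', rfl⟩ := Quotient.exists_rep j
    exact key _ _ d d' rfl rfl
  have hk1 : finrank (ZMod 2) (LinearMap.ker (incidence G).transpose.mulVecLin) ≤ 1 := by
    refine finrank_le_one_of_const _ fun φ hφ => ?_
    refine hconn.eq_of_forall_adj fun a b hab => ?_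
    have h1 : (incidence G).transpose.mulVec φ = 0 := hφ
    have := incidence_transpose_mulVec φ hab
    rw [h1] at this
    exact CharTwo.add_eq_zero.1 this.symm
  have r2 := LinearMap.finrank_range_add_finrank_ker R.faceBoundary
  have r1 := LinearMap.finrank_range_add_finrank_ker (incidence G).mulVecLin
  have r1' := LinearMap.finrank_range_add_finrank_ker (incidence G).transpose.mulVecLin
  -- The incidence matrix has rank at least `|V| - 1`, as seen from its transpose, so the cycle
  -- space has dimension at most `|E| - |V| + 1`. By Euler this is `|F| - 1`, which the rank of
  -- `faceBoundary` reaches.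
  have hrank : finrank (ZMod 2) (LinearMap.range (incidence G).mulVecLin) =
      finrank (ZMod 2) (LinearMap.range (incidence G).transpose.mulVecLin) :=
    (Matrix.rank_transpose (incidence G)).symm
  rw [finrank_fintype_fun_eq_card, ← Nat.card_eq_fintype_card] at r1 r1' r2
  omega

theorem incidence_mulVec_lift {g : V → V → ZMod 2} (hg : ∀ a b, g a b = g b a)
    (hadj : ∀ a b, g a b ≠ 0 → G.Adj a b) (v : V) :
    (incidence G).mulVec (fun e : G.edgeSet => Sym2.lift ⟨g, hg⟩ e.1) v = ∑ b, g v b := by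
  simp only [Matrix.mulVec, dotProduct, incidence, Matrix.of_apply, ite_mul, one_mul, zero_mul]
  rw [← Finset.sum_filter, ← Finset.sum_filter_add_sum_filter_not Finset.univ (G.Adj v) (g v),
    Finset.sum_eq_zero (s := Finset.univ.filter fun b => ¬ G.Adj v b), add_zero]
  · symm
    refine Finset.sum_bij (fun b hb => ⟨s(v, b), (Finset.mem_filter.1 hb).2⟩) ?_ ?_ ?_ ?_
    · intro b hb
      simp
    · intro b hb c hc h
      exact Sym2.congr_right.1 (Subtype.ext_iff.1 h)
    · rintro ⟨e, he⟩ hv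
      obtain ⟨b, rfl⟩ := Sym2.mem_iff_exists.1 (Finset.mem_filter.1 hv).2
      exact ⟨b, by simpa using he, rfl⟩
    · intro b hb
      rfl
  · intro b hb
    by_contra h
    exact (Finset.mem_filter.1 hb).2 (hadj _ _ h)

end Homology

/-- The triangles of a plane triangulation. -/
def sphereTriangulation [Fintype V] (hR : R.IsPlaneTriangulation) : SphereTriangulation G where
  Tri a b c := ∃ h : G.Adj a b, (R.facePerm ⟨(a, b), h⟩).snd = c
  adj := fun ⟨h, _⟩ => h
  rot := by
    rintro a b c ⟨h, hc⟩
    have hbc : G.Adj b c := by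
      have := (R.facePerm ⟨(a, b), h⟩).adj
      rwa [R.fst_facePerm, hc] at this
    refine ⟨hbc, ?_⟩
    have h1 := R.facePerm_eq hbc rfl hc
    have h3 := hR.2 ⟨(a, b), h⟩
    rw [h1] at h3
    have := congrArg (fun d => d.fst) h3
    simpa [R.fst_facePerm] using this
  exists_tri h := ⟨_, h, rfl⟩
  unique := by
    rintro a b c d ⟨h, rfl⟩ ⟨_, rfl⟩
    rfl
  link := by
    intro v X hX b hb hvb c hvc
    have := R.of_next (P := fun d => d.fst = v ∧ d.snd ∈ X) (d := ⟨(v, b), hvb⟩)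
      (d' := ⟨(v, c), hvc⟩) ?_ ⟨rfl, hb⟩ rfl
    · exact this.2
    rintro d ⟨rfl, hd⟩
    refine ⟨R.fst_next d, hX d.snd _ hd ?_⟩
    have h1 : (R.next d).fst = d.fst := R.fst_next d
    have hadj : G.Adj d.fst (R.next d).snd := h1 ▸ (R.next d).adj
    refine ⟨hadj, ?_⟩
    -- The next dart in the rotation follows `d.symm` on its face; since that face is a triangle, it
    -- closes up at `d.snd`.
    have h2 : R.facePerm d.symm = ⟨(d.fst, (R.next d).snd), hadj⟩ :=
      R.facePerm_eq hadj rfl (by rw [R.facePerm_apply, SimpleGraph.Dart.symm_symm])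
    have h3 := congrArg (fun d => d.fst) (hR.2 d.symm)
    rw [← h2]
    simpa [R.fst_facePerm] using h3
  connected := hR.1.1
  separates := by
    classical
    intro g hg hadj hsum
    have hmem : (fun e : G.edgeSet => Sym2.lift ⟨g, hg⟩ e.1) ∈
        LinearMap.ker (incidence G).mulVecLin := by
      rw [LinearMap.mem_ker, Matrix.mulVecLin_apply]
      ext v
      rw [incidence_mulVec_lift hg hadj, hsum]
      rfl
    rw [← R.range_faceBoundary hR.1] at hmem
    obtain ⟨f, hf⟩ := hmem
    refine ⟨{p | ∃ h : G.Adj p.1 p.2, f (R.face ⟨p, h⟩) = 1}, ?_, fun a b h => h.1, ?_⟩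
    · rintro a b c ⟨h, hc⟩ ⟨_, h1⟩
      have hbc : G.Adj b c := by
        have := (R.facePerm ⟨(a, b), h⟩).adj
        rwa [R.fst_facePerm, hc] at this
      refine ⟨hbc, ?_⟩
      rw [← h1, ← R.face_facePerm ⟨(a, b), h⟩, R.facePerm_eq (d := ⟨(a, b), h⟩) hbc rfl hc]
    · intro a b h
      have h1 := R.faceBoundary_apply f ⟨(a, b), h⟩
      rw [hf] at h1
      change g a b = _ at h1
      have h2 : ∀ x y : ZMod 2, x + y ≠ 0 ↔ ¬ (x = 1 ↔ y = 1) := by decide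
      have e1 : (a, b) ∈ {p : V × V | ∃ h : G.Adj p.1 p.2, f (R.face ⟨p, h⟩) = 1} ↔
          f (R.face ⟨(a, b), h⟩) = 1 := ⟨fun ⟨_, h⟩ => h, fun h' => ⟨h, h'⟩⟩
      have e2 : (b, a) ∈ {p : V × V | ∃ h : G.Adj p.1 p.2, f (R.face ⟨p, h⟩) = 1} ↔
          f (R.face (SimpleGraph.Dart.symm ⟨(a, b), h⟩)) = 1 :=
        ⟨fun ⟨_, h⟩ => h, fun h' => ⟨h.symm, h'⟩⟩
      rw [h1, e1, e2]
      exact h2 _ _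

end RotationSystem

/-! ### The two sides of a triangle, and the theorem. -/

namespace SphereTriangulation

variable {V F : Type*} [Fintype V] [Field F] {G : SimpleGraph V} {𝒯 : SphereTriangulation G}

/-- The set of all triangles. -/
def allDarts (G : SimpleGraph V) : Set (V × V) := {p | G.Adj p.1 p.2}

theorem isRegion_allDarts (𝒯 : SphereTriangulation G) : 𝒯.IsRegion (allDarts G) :=
  ⟨fun ht _ => 𝒯.adj (𝒯.rot ht), fun h => h⟩

/-- Every triangle of the graph splits the sphere into two disks. -/
theorem exists_disks_of_triangle (𝒯 : SphereTriangulation G) {a b c : V} (hab : G.Adj a b)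
    (hbc : G.Adj b c) (hca : G.Adj c a) :
    ∃ S, S ⊆ allDarts G ∧ 𝒯.IsDisk S a [b, c, a] ∧ 𝒯.IsDisk (allDarts G \ S) a [c, b, a] := by
  have hD := isRegion_allDarts 𝒯
  have hadj : ∀ i j, Consec [a, b, c, a] i j → G.Adj i j := by
    rintro i j (⟨rfl, rfl⟩ | ⟨rfl, rfl⟩ | ⟨rfl, rfl⟩ | h)
    exacts [hab, hbc, hca, h.elim]
  obtain ⟨R, hR, hRg⟩ := 𝒯.exists_region_of_closed_list (a := a) (l := [b, c, a]) rfl hadj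
  have hne1 := hab.ne
  have hne2 := hbc.ne
  have hne3 := hca.ne
  have hx : ¬ ((a, b) ∈ R ↔ (b, a) ∈ R) := by
    rw [← hRg a b hab]
    simp [consecCount, hne1, hne2, hne1.symm, hne3.symm]
  have hx2 : ∀ i j, G.Adj i j → ¬ ((i, j) ∈ R ↔ (j, i) ∈ R) →
      Consec [a, b, c, a] i j ∨ Consec [a, b, c, a] j i := by
    intro i j hij h
    by_contra hn
    rw [not_or] at hn
    rw [← hRg i j hij, consecCount_eq_zero hn.1, consecCount_eq_zero hn.2, add_zero] at h
    exact h rfl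
  -- After passing to the complement of `R` if necessary, `ab` has the region on its left only.
  obtain ⟨S, hS, habS, hS2⟩ : ∃ S, 𝒯.IsRegion S ∧ Bd S a b ∧
      ∀ i j, Bd S i j → Consec [a, b, c, a] i j ∨ Consec [a, b, c, a] j i := by
    by_cases h : (a, b) ∈ R
    · exact ⟨R, hR, ⟨h, fun h' => hx (iff_of_true h h')⟩, fun i j hij =>
        hx2 i j (hR.adj hij.1) fun h => hij.2 (h.1 hij.1)⟩
    · have h' : (b, a) ∈ R := by tauto
      refine ⟨allDarts G \ R, hD.diff hR, ⟨⟨hab, h⟩, fun h => h.2 h'⟩, fun i j hij =>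
        hx2 i j hij.1.1 fun h => hij.2 ⟨SimpleGraph.Adj.symm hij.1.1, fun h' => hij.1.2 (h.2 h')⟩⟩
  have hbd1 : ∀ i j, Bd S i j → (i = a ∧ j = b) ∨ (i = b ∧ j = c) ∨ (i = c ∧ j = a) ∨
      (i = b ∧ j = a) ∨ (i = c ∧ j = b) ∨ (i = a ∧ j = c) := by
    intro i j h
    have := hS2 i j h
    simp only [consec_cons_cons, consec_singleton, or_false] at this
    tauto
  have hno : ∀ {i j}, Bd S i j → ¬ Bd S j i := fun h h' => h.2 h'.1
  -- The boundary entering `b` must leave it along a side of the triangle, and turning back to `a`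
  -- is impossible.
  have hbcS : Bd S b c := by
    obtain ⟨d, hd⟩ := hS.exists_bd_out habS
    have h1 := hno habS
    rcases hbd1 _ _ hd with ⟨rfl, rfl⟩ | ⟨-, rfl⟩ | ⟨rfl, rfl⟩ | ⟨-, rfl⟩ | ⟨rfl, rfl⟩ | ⟨rfl, rfl⟩ <;>
      simp_all
  have hcaS : Bd S c a := by
    obtain ⟨d, hd⟩ := hS.exists_bd_out hbcS
    have h1 := hno hbcS
    rcases hbd1 _ _ hd with ⟨rfl, rfl⟩ | ⟨rfl, rfl⟩ | ⟨-, rfl⟩ | ⟨rfl, rfl⟩ | ⟨-, rfl⟩ | ⟨rfl, rfl⟩ <;>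
      simp_all
  have hbd : ∀ i j, Bd S i j ↔ Consec [a, b, c, a] i j := by
    have h1 : ∀ i j, Consec [a, b, c, a] i j → Bd S i j := by
      rintro i j (⟨rfl, rfl⟩ | ⟨rfl, rfl⟩ | ⟨rfl, rfl⟩ | h)
      exacts [habS, hbcS, hcaS, h.elim]
    exact fun i j => ⟨fun h => (hS2 i j h).resolve_right fun h' => hno h (h1 _ _ h'), h1 i j⟩
  have hSD : S ⊆ allDarts G := fun p hp => hS.adj hp
  refine ⟨S, hSD, ⟨hS, ?_, rfl, hbd⟩, ⟨hD.diff hS, ?_, rfl, fun i j => ?_⟩⟩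
  · simp [hne1.symm, hne2, hne3]
  · simp [hne1.symm, hne2.symm, hne3]
  · have h1 : Bd (allDarts G \ S) i j ↔ Bd S j i := by
      constructor
      · rintro ⟨⟨h1, h2⟩, h3⟩
        refine ⟨?_, h2⟩
        by_contra h
        exact h3 ⟨SimpleGraph.Adj.symm h1, h⟩
      · rintro ⟨h1, h2⟩
        exact ⟨⟨(hS.adj h1).symm, h2⟩, fun h => h.2 h1⟩
    rw [h1, hbd]
    simp only [consec_cons_cons, consec_singleton, or_false]
    tauto

open Classical in
-- The disk monomial for the special edge `ba` has degree 0 at `a` and `b`, so the factors of `ca`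
-- and `cb` both contribute `c`. They use up the whole degree 2 allowed at `c`, and removing them
-- leaves degree 0 there.
theorem IsDisk.exists_monomial_of_triangle {lin : Sym2 V → MvPolynomial V F}
    (hlin : IsEdgeForm G lin) {S : Set (V × V)} {a b c : V} (hD : 𝒯.IsDisk S a [b, c, a]) :
    ∃ N : V →₀ ℕ, coeff N (∏ e ∈ edges S \ {s(a, b), s(b, c), s(c, a)}, lin e) ≠ 0 ∧
      N a = 0 ∧ N b = 0 ∧ N c = 0 ∧ ∀ z, N z ≤ 4 := by
  obtain ⟨N, h1, h2, h3, h4, h5⟩ := hD.exists_monomial hlin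
  have hnd := hD.nodup
  have hbc : Bd S b c := (hD.bd_iff _ _).2 (.inr (.inl ⟨rfl, rfl⟩))
  have hca : Bd S c a := (hD.bd_iff _ _).2 (.inr (.inr (.inl ⟨rfl, rfl⟩)))
  simp only [List.nodup_cons, List.mem_cons, List.not_mem_nil, or_false, not_or] at hnd
  obtain ⟨⟨hne1, hne2⟩, hne3, -⟩ := hnd
  have hE : (edges S).erase s(b, a) =
      insert s(c, a) (insert s(c, b) (edges S \ {s(a, b), s(b, c), s(c, a)})) := by
    ext e
    have e1 : s(c, a) ∈ edges S := mk_mem_edges.2 (.inl hca.1)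
    have e2 : s(c, b) ∈ edges S := mk_mem_edges.2 (.inr hbc.1)
    have e3 : s(c, a) ≠ s(b, a) := by simp [Ne.symm hne1, Ne.symm hne2]
    have e4 : s(c, b) ≠ s(b, a) := by simp [hne3, Ne.symm hne1]
    simp only [Finset.mem_erase, Finset.mem_insert, Finset.mem_sdiff, Finset.mem_singleton,
      Sym2.eq_swap (a := a) (b := b), Sym2.eq_swap (a := b) (b := c)]
    constructor
    · rintro ⟨h1, h2⟩
      tauto
    · rintro (rfl | rfl | ⟨h1, h2⟩)
      · exact ⟨e3, e1⟩
      · exact ⟨e4, e2⟩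
      · tauto
  obtain ⟨u₁, u₂, -, -, hu⟩ := hlin c a (hD.region.adj hca.1)
  obtain ⟨w₁, w₂, -, -, hw⟩ := hlin c b (hD.region.adj hbc.1).symm
  rw [hE, Finset.prod_insert, Finset.prod_insert, hu, hw] at h1
  · obtain ⟨M, rfl, hM⟩ := coeff_linear_mul_ne_zero h3 h1
    simp only [Finsupp.add_apply] at h2 h3 h4 h5
    obtain ⟨M, rfl, hM'⟩ := coeff_linear_mul_ne_zero (by omega) hM
    have hc := h4 c (by simp)
    simp only [Finsupp.add_apply, Finsupp.single_eq_same] at h2 h3 hc h5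
    exact ⟨M, hM', by omega, by omega, by omega, fun z => by have := h5 z; omega⟩
  · simp [Sym2.eq_swap (a := b) (b := c)]
  · simp [Ne.symm hne2, Ne.symm hne3]

open Classical in
-- The two sides meet only in `a`, `b`, `c`, which neither monomial contains, so the product of the
-- monomials survives.
theorem exists_monomial_of_triangle (𝒯 : SphereTriangulation G)
    {lin : Sym2 V → MvPolynomial V F} (hlin : IsEdgeForm G lin) {a b c : V} (hab : G.Adj a b)
    (hbc : G.Adj b c) (hca : G.Adj c a) :
    ∃ N : V →₀ ℕ, coeff N (∏ e ∈ edges (allDarts G) \ {s(a, b), s(b, c), s(c, a)}, lin e) ≠ 0 ∧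
      N a = 0 ∧ N b = 0 ∧ N c = 0 ∧ ∀ z, N z ≤ 4 := by
  obtain ⟨S, hSD, hS, hS'⟩ := exists_disks_of_triangle 𝒯 hab hbc hca
  obtain ⟨N₁, a1, a2, a3, a4, a5⟩ := hS.exists_monomial_of_triangle hlin
  obtain ⟨N₂, b1, b2, b3, b4, b5⟩ := hS'.exists_monomial_of_triangle hlin
  have htri : ({s(a, c), s(c, b), s(b, a)} : Finset (Sym2 V)) = {s(a, b), s(b, c), s(c, a)} := by
    ext e
    simp only [Finset.mem_insert, Finset.mem_singleton, Sym2.eq_swap (a := a) (b := c),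
      Sym2.eq_swap (a := c) (b := b), Sym2.eq_swap (a := b) (b := a)]
    tauto
  rw [htri] at b1
  have hdisj : Disjoint S (allDarts G \ S) := Set.disjoint_sdiff_right
  have hE : edges (allDarts G) \ {s(a, b), s(b, c), s(c, a)} =
      (edges S \ {s(a, b), s(b, c), s(c, a)}) ∪
        (edges (allDarts G \ S) \ {s(a, b), s(b, c), s(c, a)}) := by
    rw [← Finset.union_sdiff_distrib]
    congr 1
    ext e
    rw [Finset.mem_union]
    constructor
    · intro he
      obtain ⟨i, j, hij, rfl⟩ := mem_edges.1 he
      by_cases h : (i, j) ∈ S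
      · exact .inl (mk_mem_edges.2 (.inl h))
      · exact .inr (mk_mem_edges.2 (.inl ⟨hij, h⟩))
    · rintro (h | h)
      · exact edges_mono hSD h
      · exact edges_mono Set.sdiff_subset h
  have hd : Disjoint (edges S \ {s(a, b), s(b, c), s(c, a)})
      (edges (allDarts G \ S) \ {s(a, b), s(b, c), s(c, a)}) := by
    rw [Finset.disjoint_left]
    intro e h1 h2
    obtain ⟨h1, hn⟩ := Finset.mem_sdiff.1 h1
    obtain ⟨i, j, hij, rfl⟩ := mem_edges.1 h1
    have hji : (j, i) ∉ S := by
      rcases mk_mem_edges.1 (Finset.mem_sdiff.1 h2).1 with h | h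
      · exact (h.2 hij).elim
      · exact h.2
    refine hn ?_
    have := (hS.bd_iff i j).1 ⟨hij, hji⟩
    simp only [consec_cons_cons, consec_singleton, or_false] at this
    rcases this with ⟨rfl, rfl⟩ | ⟨rfl, rfl⟩ | ⟨rfl, rfl⟩ <;> simp
  have hz₁ := fun M hM z hz => hS.region.not_mem_edges_of_coeff hlin
    (Finset.sdiff_subset (t := {s(a, b), s(b, c), s(c, a)})) (M := M) hM (z := z) hz
  have hz₂ := fun M hM z hz => hS'.region.not_mem_edges_of_coeff hlin
    (Finset.sdiff_subset (t := {s(a, b), s(b, c), s(c, a)})) (M := M) hM (z := z) hz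
  have hcommon : ∀ z, z ∈ {z | ∃ e ∈ edges S, z ∈ e} →
      z ∈ {z | ∃ e ∈ edges (allDarts G \ S), z ∈ e} → N₂ z = 0 := by
    rintro z ⟨e₁, he₁, hz₁⟩ ⟨e₂, he₂, hz₂⟩
    have := hS.mem_of_mem_edges hS'.region hdisj he₁ hz₁ he₂ hz₂
    simp only [List.mem_cons, List.not_mem_nil, or_false] at this
    rcases this with rfl | rfl | rfl <;> assumption
  refine ⟨N₁ + N₂, ?_, by simp [a2, b2], by simp [a3, b4], by simp [a4, b3], fun z => ?_⟩
  · rw [hE, Finset.prod_union hd, coeff_add_mul_of_disjoint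
      (isHomogeneous_prod_edgeForm hlin fun e he =>
        hS'.region.edges_subset (Finset.mem_sdiff.1 he).1) hz₁ hz₂ a1 b1 hcommon]
    exact mul_ne_zero a1 b1
  · rw [Finsupp.add_apply]
    by_cases h1 : z ∈ {z | ∃ e ∈ edges S, z ∈ e}
    · by_cases h2 : z ∈ {z | ∃ e ∈ edges (allDarts G \ S), z ∈ e}
      · rw [hcommon z h1 h2, add_zero]; exact a5 z
      · rw [hz₂ _ b1 z h2, add_zero]; exact a5 z
    · rw [hz₁ _ a1 z h1, zero_add]; exact b5 z

end SphereTriangulation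

theorem mainTheorem8 {V : Type*} [Fintype V] [LinearOrder V] (G : SimpleGraph V)
    (R : RotationSystem G) (hR : R.IsPlaneTriangulation)
    (T : Finset V) (hT : G.IsNClique 3 T)
    {F : Type*} [Field F]
    (δ : EdgeDecoration (G.deleteEdges (T.sym2 : Set (Sym2 V))) F) :
    ∃ N : V →₀ ℕ,
      MvPolynomial.coeff N
          (decoratedPolynomial (G.deleteEdges (T.sym2 : Set (Sym2 V))) δ) ≠ 0 ∧
      (∀ u ∈ T, N u = 0) ∧
      (∀ w : V, w ∉ T → N w ≤ 4) := by
  classical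
  obtain ⟨a, b, c, hab, hac, hbc, rfl⟩ := SimpleGraph.is3Clique_iff.1 hT
  -- Outside the decorated edges, in particular on the sides of `T`, the decoration may vanish;
  -- zeros are replaced by 1 so that every edge of `G` has a form with non-zero coefficients. The
  -- sides of `T` do not enter the final product.
  set lin : Sym2 V → MvPolynomial V F := fun e =>
    C (if δ.a e = 0 then 1 else δ.a e) * X e.inf + C (if δ.b e = 0 then 1 else δ.b e) * X e.sup
    with hlin_def
  have hlin : IsEdgeForm G lin := by
    intro i j _
    have h1 : ∀ x : F, (if x = 0 then 1 else x) ≠ 0 := fun x => by split_ifs <;> simp_all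
    rcases le_total i j with h | h
    · exact ⟨_, _, h1 (δ.a s(i, j)), h1 (δ.b s(i, j)), by simp [hlin_def, h]⟩
    · exact ⟨_, _, h1 (δ.b s(i, j)), h1 (δ.a s(i, j)), by simp [hlin_def, h, add_comm]⟩
  obtain ⟨N, h1, h2, h3, h4, h5⟩ :=
    (R.sphereTriangulation hR).exists_monomial_of_triangle hlin hab hbc hac.symm
  have hE : ∀ e, e ∈ (G.deleteEdges (({a, b, c} : Finset V).sym2 : Set (Sym2 V))).edgeSet ↔
      e ∈ SphereTriangulation.edges (SphereTriangulation.allDarts G) ∧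
        ¬ (e = s(a, b) ∨ e = s(b, c) ∨ e = s(c, a)) := by
    intro e
    induction e with | _ i j
    simp only [SimpleGraph.mem_edgeSet, SimpleGraph.deleteEdges_adj,
      SphereTriangulation.mk_mem_edges, SphereTriangulation.allDarts, Set.mem_ofPred_eq,
      G.adj_comm j i, or_self, Finset.mem_coe, Finset.mk_mem_sym2_iff, Finset.mem_insert,
      Finset.mem_singleton, Sym2.eq_iff]
    refine and_congr_right fun h => not_congr ?_
    have := h.ne
    constructor
    · rintro ⟨rfl | rfl | rfl, rfl | rfl | rfl⟩ <;> simp_all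
    · tauto
  have hmem : ∀ (H : SimpleGraph V) (_ : Fintype H.edgeSet) (e : Sym2 V),
      e ∈ H.edgeFinset ↔ e ∈ H.edgeSet := fun _ _ _ => SimpleGraph.mem_edgeFinset
  refine ⟨N, ?_, ?_, fun w _ => h5 w⟩
  · convert h1 using 2
    rw [decoratedPolynomial]
    refine Finset.prod_congr ?_ fun e he => ?_
    · ext e
      rw [hmem, hE]
      simp only [Finset.mem_sdiff, Finset.mem_insert, Finset.mem_singleton]
    · simp only [Finset.mem_sdiff, Finset.mem_insert, Finset.mem_singleton] at he
      have he' := (hE e).2 he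
      simp only [hlin_def]
      rw [if_neg (δ.a_ne_zero e he'), if_neg (δ.b_ne_zero e he')]
  · intro u hu
    simp only [Finset.mem_insert, Finset.mem_singleton] at hu
    rcases hu with rfl | rfl | rfl <;> assumption
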